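/- Let $n\ge 2$ be an integer. Consider the differential system (the axisymmetric capillary equation in $\mathbb{R}^{n+1}$ with $\kappa=n-1$) \[ \frac{dr}{dz}=-\tan\theta,\qquad \frac{d\theta}{dz}=(n-1)\Bigl(\frac{z}{\cos\theta}-\frac1r\Bigr),\qquad\text{where } r>0 \text{ and } \theta\in\Bigl(-\frac{\pi}{2},\frac{\pi}{2}\Bigr). \] There exists exactly one solution $z\mapsto(r(z),\theta(z))$ of this system that is defined on all of $(0,+\infty)$. This solution satisfies \[ r(z)\sim \frac1z\quad\text{and}\quad \theta(z)\to 0\qquad\text{as } z\to+\infty . \] -/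

import Mathlib

open Filter Set Asymptotics
open scoped Topology

/-- `z ↦ (r z, θ z)` is a solution, defined on all of `(0, +∞)`, of the system
`dr/dz = -tan θ`, `dθ/dz = (n - 1) (z / cos θ - 1 / r)`, with `r > 0` and
`θ ∈ (-π/2, π/2)`. Values of `r` and `θ` outside `(0, +∞)` are irrelevant. -/
structure IsCapillarySolution (n : ℕ) (r θ : ℝ → ℝ) : Prop where
  r_pos : ∀ z : ℝ, 0 < z → 0 < r z
  theta_mem : ∀ z : ℝ, 0 < z → θ z ∈ Ioo (-(Real.pi / 2)) (Real.pi / 2)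
  deriv_r : ∀ z : ℝ, 0 < z → HasDerivAt r (-Real.tan (θ z)) z
  deriv_theta : ∀ z : ℝ, 0 < z →
    HasDerivAt θ (((n : ℝ) - 1) * (z / Real.cos (θ z) - 1 / r z)) z

/-! Write `m = n - 1`, `u = z * r`, `c = cos θ`. The Hamiltonian `H` decreases in `z`, and `z ^ m *
H` is the `energy` of `(u, c)`, whose maximum `1 / (m + 1)` is attained at `u = c = 1`. A global
solution has `H ≥ 0`, since otherwise `θ' ≥ 1` from some height on and `θ` leaves its interval
(`hamiltonian_nonneg_of_global`).

The region `H ≥ 0` is repelling in `z`: after a correction of order `1 / z ^ 2`, the gap between the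
energy and its maximum grows at least like `z ^ κ`, up to an error of order `1 / z ^ 2`. As the gap
is bounded where `H ≥ 0`, a global solution has gap `O(1 / z ^ 2)` (`exists_energy_gap_bound`),
which gives `z * r → 1` and `θ → 0`.

Uniqueness needs the sign of `θ`: a finer gap estimate shows `sin θ > 0` for large `z`
(`eventually_sin_pos`). A weighted squared distance between two global solutions is then
nondecreasing and tends to `0`, hence vanishes for large `z`; uniqueness for the initial value
problem carries equality down to every `z > 0`.

Existence: start at `(1 / N, 0)` at height `N` and solve towards `0`. There `H` only increases, so
the solution stays in a compact box (`exists_solution_left`). The gap estimate makes the box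
independent of `N` (`exists_uniform_box`), and a limit as `N → ∞` is a global solution. -/

/-- The pair `(r, θ)` solves the capillary system at the point `z`, with `m = n - 1`. -/
structure CapillaryAt (m : ℕ) (r θ : ℝ → ℝ) (z : ℝ) : Prop where
  z_pos : 0 < z
  r_pos : 0 < r z
  theta_mem : θ z ∈ Ioo (-(Real.pi / 2)) (Real.pi / 2)
  deriv_r : HasDerivAt r (-Real.tan (θ z)) z
  deriv_theta : HasDerivAt θ ((m : ℝ) * (z / Real.cos (θ z) - 1 / r z)) z

/-! ### Algebra of the frozen energy -/

/-- The energy of the system with `z` frozen, in the variables `u = z * r` and `c = cos θ`. -/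
noncomputable def energy (m : ℕ) (u c : ℝ) : ℝ := u ^ m * c - m / (m + 1) * u ^ (m + 1)

/-- The right side equals `(u - 1) ^ 2` times the sum of `(k + 1) * u ^ k` over `k < m`; only the
term `k = 0` is kept. -/
lemma sq_sub_one_le (m : ℕ) (hm : 1 ≤ m) {u : ℝ} (hu : 0 ≤ u) :
    (u - 1) ^ 2 ≤ 1 - (m + 1) * u ^ m + m * u ^ (m + 1) := by
  induction m, hm using Nat.le_induction with
  | base => norm_num; nlinarith
  | succ k hk ih =>
    have : 0 ≤ ((k : ℝ) + 1) * u ^ k * (u - 1) ^ 2 := by positivity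
    push_cast
    have e : 1 - ((k : ℝ) + 1 + 1) * u ^ (k + 1) + (k + 1) * u ^ (k + 1 + 1)
      = (1 - (k + 1) * u ^ k + k * u ^ (k + 1)) + ((k : ℝ) + 1) * u ^ k * (u - 1) ^ 2 := by ring
    linarith

/-- Coercivity: a small gap forces `u` close to `1`, and then `c` close to `1`. -/
lemma le_energy_gap (m : ℕ) (hm : 1 ≤ m) {u : ℝ} (hu : 0 ≤ u) (c : ℝ) :
    u ^ m * (1 - c) + (u - 1) ^ 2 / (m + 1) ≤ 1 / (m + 1) - energy m u c := by
  have h := sq_sub_one_le m hm hu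
  have hm' : (0 : ℝ) < m + 1 := by positivity
  have : 1 / ((m : ℝ) + 1) - energy m u c - u ^ m * (1 - c)
      = (1 - (m + 1) * u ^ m + m * u ^ (m + 1)) / (m + 1) := by
    unfold energy; field_simp; ring
  have h2 : (u - 1) ^ 2 / ((m : ℝ) + 1) ≤ (1 - (m + 1) * u ^ m + m * u ^ (m + 1)) / (m + 1) := by
    gcongr
  linarith

/-- Bernoulli's inequality for `u ^ (m + 1)`. The right side has the shape of the terms of
`dissipation`. -/
lemma energy_gap_le (m : ℕ) {u : ℝ} (hu : 0 ≤ u) (c : ℝ) :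
    1 / (m + 1) - energy m u c ≤ u ^ m * (1 - c) + (u - 1) * (u ^ m - 1) := by
  have h := one_add_mul_le_pow (show (-2 : ℝ) ≤ u - 1 by linarith) (m + 1)
  have hm' : (0 : ℝ) < m + 1 := by positivity
  have : u ^ m * (1 - c) + (u - 1) * (u ^ m - 1) - (1 / (m + 1) - energy m u c)
      = (u ^ (m + 1) - (m + 1) * u + m) / (m + 1) := by
    unfold energy; field_simp; ring
  have h2 : 0 ≤ (u ^ (m + 1) - (m + 1) * u + m) / ((m : ℝ) + 1) := by
    apply div_nonneg _ hm'.le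
    push_cast at h
    rw [show (1 : ℝ) + (u - 1) = u by ring] at h
    linarith
  linarith

/-- The rate of change of the corrected energy, to leading order in `1 / z`. -/
noncomputable def dissipation (m : ℕ) (ε u c : ℝ) : ℝ :=
  -(m + 1) * (1 - ε) * u ^ m * ((1 - c ^ 2) / c) - ε * ((1 - c ^ 2) / c)
    - ε * m * (u - c) * (u ^ m - 1)

/-- Three regimes, each with its own dominant term: `ε * (1 - c ^ 2) / c` when `c` is small, the
product `(u - c) * (u ^ m - 1)` when `u` is small compared with `c`, and the term with `u ^ m`
otherwise. The hypothesis `huc` expresses that the energy is nonnegative, so the gap is at most `1`.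
-/
lemma dissipation_le (m : ℕ) (hm : 1 ≤ m) {u c ε : ℝ} (hu : 0 < u) (hc : 0 < c) (hc1 : c ≤ 1)
    (huc : m * u ≤ (m + 1) * c) (hε : ε = (1 / 4) ^ m / 4) :
    dissipation m ε u c ≤ -(ε / 8) * (1 / (m + 1) - energy m u c) := by
  have hm1 : (1 : ℝ) ≤ m := by exact_mod_cast hm
  have hε0 : 0 < ε := by rw [hε]; positivity
  have hε1 : ε ≤ 1 / 4 := by
    have : (1 / 4 : ℝ) ^ m ≤ 1 := pow_le_one₀ (by norm_num) (by norm_num)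
    rw [hε]; linarith
  have hum : 0 < u ^ m := by positivity
  have hsc : 1 - c ≤ (1 - c ^ 2) / c := by
    rw [le_div_iff₀ hc]; nlinarith
  have hE0 : 0 ≤ energy m u c := by
    have : energy m u c = u ^ m * ((m + 1) * c - m * u) / (m + 1) := by
      unfold energy; field_simp; ring
    rw [this]
    have : 0 ≤ (m + 1) * c - m * u := by linarith
    positivity
  have hP1 : 1 / ((m : ℝ) + 1) - energy m u c ≤ 1 := by
    have : 1 / ((m : ℝ) + 1) ≤ 1 := by rw [div_le_one (by positivity)]; linarith
    linarith
  have hP := energy_gap_le m hu.le c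
  have hq0 : 0 ≤ (1 - c ^ 2) / c := by linarith
  have hmain : 0 ≤ (m + 1) * (1 - ε) * u ^ m * ((1 - c ^ 2) / c) := by
    have : 0 ≤ 1 - ε := by linarith
    positivity
  unfold dissipation
  rcases le_total c (1 / 2) with h1 | h1
  · have hb : -(m * ((u - c) * (u ^ m - 1))) ≤ c := by
      rcases le_total u 1 with hu1 | hu1
      · have h1' : u ^ m ≤ 1 := pow_le_one₀ hu.le hu1
        have : m * (u - c) * (1 - u ^ m) ≤ c * (1 - u ^ m) := by
          apply mul_le_mul_of_nonneg_right _ (by linarith)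
          linarith
        nlinarith
      · have h1' : 1 ≤ u ^ m := one_le_pow₀ hu1
        have : 0 ≤ m * ((u - c) * (u ^ m - 1)) := by
          have : 0 ≤ u - c := by linarith
          have : 0 ≤ u ^ m - 1 := by linarith
          positivity
        linarith
    have hq : 1 + c ≤ (1 - c ^ 2) / c := by
      rw [le_div_iff₀ hc]; nlinarith
    have : ε * (1 / ((m : ℝ) + 1) - energy m u c) ≤ ε * 1 := by gcongr
    have h3 : ε * (1 + c) ≤ ε * ((1 - c ^ 2) / c) := by gcongr
    have h4 : ε * (-(m * ((u - c) * (u ^ m - 1)))) ≤ ε * c := by gcongr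
    nlinarith
  · rcases le_total u (c / 2) with h2 | h2
    · have h1' : u ^ m ≤ 1 / 2 := by
        calc u ^ m ≤ u ^ 1 := pow_le_pow_of_le_one hu.le (by linarith) hm
          _ ≤ 1 / 2 := by linarith
      have h3 : 1 / 8 ≤ (u - c) * (u ^ m - 1) := by
        have : 1 / 4 * (1 / 2) ≤ (c - u) * (1 - u ^ m) := by
          apply mul_le_mul <;> linarith
        nlinarith
      have h4 : 1 / 8 ≤ m * ((u - c) * (u ^ m - 1)) := by nlinarith
      have : ε * (1 / ((m : ℝ) + 1) - energy m u c) ≤ ε * 1 := by gcongr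
      have h5 : ε * (1 / 8) ≤ ε * (m * ((u - c) * (u ^ m - 1))) := by gcongr
      have h6 : 0 ≤ ε * ((1 - c ^ 2) / c) := by positivity
      nlinarith
    -- Here `u ≥ c / 2 ≥ 1 / 4`. The value of `ε` makes `ε * m * (1 - c)`, the cost of replacing `u
    -- - c` by `u - 1`, absorbable by the term with `u ^ m`.
    · have h3 : 4 * ε ≤ u ^ m := by
        rw [hε]
        have : (1 / 4 : ℝ) ^ m ≤ u ^ m := by gcongr; linarith
        linarith
      have hg : 0 ≤ (u - 1) * (u ^ m - 1) := by
        rcases le_total u 1 with hu1 | hu1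
        · have h1' : u ^ m ≤ 1 := pow_le_one₀ hu.le hu1
          nlinarith
        · have h1' : 1 ≤ u ^ m := one_le_pow₀ hu1
          nlinarith
      have h4 : (m + 1) * (3 / 4) * (u ^ m * (1 - c))
          ≤ (m + 1) * (1 - ε) * u ^ m * ((1 - c ^ 2) / c) := by
        rw [show (m + 1) * (1 - ε) * u ^ m * ((1 - c ^ 2) / c)
          = (m + 1) * (1 - ε) * (u ^ m * ((1 - c ^ 2) / c)) by ring]
        have : 0 ≤ 1 - c := by linarith
        have : 3 / 4 ≤ 1 - ε := by linarith
        have : 0 ≤ 1 - ε := by linarith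
        gcongr
      have h5 : ε * m * (1 - c) ≤ m / 4 * (u ^ m * (1 - c)) := by
        have : 0 ≤ 1 - c := by linarith
        have := mul_le_mul_of_nonneg_right h3 (show 0 ≤ m * (1 - c) by positivity)
        nlinarith
      have h6 : 0 ≤ ε * ((1 - c ^ 2) / c) := by positivity
      have h7 : -(ε * m * (u - c) * (u ^ m - 1)) ≤ ε * m * (1 - c)
          - ε * m * ((u - 1) * (u ^ m - 1)) := by
        have : 0 ≤ ε * m * (1 - c) * u ^ m := by
          have : 0 ≤ 1 - c := by linarith
          positivity
        nlinarith
      have hx : 0 ≤ u ^ m * (1 - c) := by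
        have : 0 ≤ 1 - c := by linarith
        positivity
      have h8 : ε / 8 * (1 / (m + 1) - energy m u c)
          ≤ ε / 8 * (u ^ m * (1 - c) + (u - 1) * (u ^ m - 1)) := by gcongr
      have h9 : ε / 8 * ((u - 1) * (u ^ m - 1)) ≤ ε * m * ((u - 1) * (u ^ m - 1)) := by
        apply mul_le_mul_of_nonneg_right _ hg
        nlinarith
      have h10 : ε / 8 * (u ^ m * (1 - c)) ≤ 1 / 2 * (u ^ m * (1 - c)) := by
        apply mul_le_mul_of_nonneg_right _ hx
        linarith
      have h11 : 0 ≤ (m - 1) * (u ^ m * (1 - c)) := mul_nonneg (by linarith) hx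
      linarith

/-! ### Derivatives along a solution -/

namespace CapillaryAt

variable {m : ℕ} {r θ : ℝ → ℝ} {z : ℝ}

lemma cos_pos (h : CapillaryAt m r θ z) : 0 < Real.cos (θ z) := Real.cos_pos_of_mem_Ioo h.theta_mem

/-- The unsimplified `z * r z / z` lets the product `z * r z` be generalized to one variable later.
-/
lemma hasDerivAt_mul (h : CapillaryAt m r θ z) :
    HasDerivAt (fun z => z * r z)
      (z * r z / z - z * (Real.sin (θ z) / Real.cos (θ z))) z := by
  have h0 := h.z_pos
  refine ((hasDerivAt_id z).mul h.deriv_r).congr_deriv ?_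
  rw [Real.tan_eq_sin_div_cos]
  simp only [id]
  field_simp
  ring

lemma hasDerivAt_sin (h : CapillaryAt m r θ z) :
    HasDerivAt (fun z => Real.sin (θ z))
      (m * z * (1 - Real.cos (θ z) / (z * r z))) z := by
  have h0 := h.z_pos
  have h1 := h.r_pos
  have h2 := h.cos_pos
  convert h.deriv_theta.sin using 1
  field_simp

lemma hasDerivAt_cos (h : CapillaryAt m r θ z) :
    HasDerivAt (fun z => Real.cos (θ z))
      (-Real.sin (θ z) * (m * z * (1 / Real.cos (θ z) - 1 / (z * r z)))) z := by
  have h0 := h.z_pos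
  have h1 := h.r_pos
  have h2 := h.cos_pos
  convert h.deriv_theta.cos using 1
  field_simp

end CapillaryAt

/-- The frozen energy with the correction of order `1 / z ^ 2` that makes it almost monotone. -/
noncomputable def correctedEnergy (m : ℕ) (ε : ℝ) (r θ : ℝ → ℝ) (z : ℝ) : ℝ :=
  energy m (z * r z) (Real.cos (θ z))
    + ((1 - ε) * ((z * r z) ^ (m + 1) * Real.sin (θ z)) + ε * ((z * r z) * Real.sin (θ z))) / z ^ 2

/-- The energy alone has derivative `m * u ^ m * (c - u) / z`, which has no sign. Correcting by `u ^
(m + 1) * sin θ / z ^ 2` cancels it and leaves a damping of the angle only; giving weight `ε` to `u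
* sin θ / z ^ 2` instead also produces damping in `u`. -/
lemma hasDerivAt_correctedEnergy {m : ℕ} (hm : 1 ≤ m) (ε : ℝ) {r θ : ℝ → ℝ} {z : ℝ}
    (h : CapillaryAt m r θ z) :
    HasDerivAt (correctedEnergy m ε r θ)
      (dissipation m ε (z * r z) (Real.cos (θ z)) / z
        + ((1 - ε) * (m - 1) * ((z * r z) ^ (m + 1) * Real.sin (θ z))
          - ε * ((z * r z) * Real.sin (θ z))) / z ^ 3) z := by
  obtain ⟨k, rfl⟩ : ∃ k, m = k + 1 := ⟨m - 1, by omega⟩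
  have hz := h.z_pos
  have hr := h.r_pos
  have hc := h.cos_pos
  have du := h.hasDerivAt_mul
  have ds := h.hasDerivAt_sin
  have dc := h.hasDerivAt_cos
  have hu : 0 < z * r z := by positivity
  have hs := Real.sin_sq_add_cos_sq (θ z)
  have key := (((du.fun_pow (k + 1)).fun_mul dc).fun_sub
    ((du.fun_pow (k + 1 + 1)).const_mul (((k + 1 : ℕ) : ℝ) / ((k + 1 : ℕ) + 1)))).fun_add
    (((((du.fun_pow (k + 1 + 1)).fun_mul ds).const_mul (1 - ε)).fun_add
      ((du.fun_mul ds).const_mul ε)).fun_div (hasDerivAt_pow 2 z) (by positivity))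
  refine key.congr_deriv ?_
  unfold dissipation
  generalize Real.cos (θ z) = c at *
  generalize Real.sin (θ z) = s at *
  generalize z * r z = u at *
  rw [show 1 - c ^ 2 = s ^ 2 by linarith]
  push_cast
  have hk : (0 : ℝ) < (k : ℝ) + 1 + 1 := by positivity
  field_simp
  ring

/-- The Hamiltonian of the capillary system. -/
noncomputable def hamiltonian (m : ℕ) (r θ : ℝ → ℝ) (z : ℝ) : ℝ :=
  r z ^ m * Real.cos (θ z) - m / (m + 1) * (z * r z ^ (m + 1))

lemma energy_eq_hamiltonian (m : ℕ) (r θ : ℝ → ℝ) (z : ℝ) :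
    energy m (z * r z) (Real.cos (θ z)) = z ^ m * hamiltonian m r θ z := by
  unfold energy hamiltonian
  ring

/-- The variables `r` and `r ^ m * sin θ` are canonically conjugate, so only the explicit dependence
on `z` contributes. -/
lemma hasDerivAt_hamiltonian {m : ℕ} (hm : 1 ≤ m) {r θ : ℝ → ℝ} {z : ℝ}
    (h : CapillaryAt m r θ z) :
    HasDerivAt (hamiltonian m r θ) (-(m / (m + 1)) * r z ^ (m + 1)) z := by
  obtain ⟨k, rfl⟩ : ∃ k, m = k + 1 := ⟨m - 1, by omega⟩
  have hz := h.z_pos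
  have hr := h.r_pos
  have hc := h.cos_pos
  have key := ((h.deriv_r.fun_pow (k + 1)).fun_mul h.deriv_theta.cos).fun_sub
    (((hasDerivAt_id z).fun_mul (h.deriv_r.fun_pow (k + 1 + 1))).const_mul
      (((k + 1 : ℕ) : ℝ) / ((k + 1 : ℕ) + 1)))
  refine key.congr_deriv ?_
  rw [Real.tan_eq_sin_div_cos]
  simp only [id]
  have hk : (0 : ℝ) < (k : ℝ) + 1 + 1 := by positivity
  push_cast
  field_simp
  ring

lemma antitoneOn_hamiltonian {m : ℕ} (hm : 1 ≤ m) {r θ : ℝ → ℝ} {s : Set ℝ} (hs : Convex ℝ s)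
    (h : ∀ z ∈ s, CapillaryAt m r θ z) : AntitoneOn (hamiltonian m r θ) s := by
  apply antitoneOn_of_deriv_nonpos hs
  · exact fun z hz => (hasDerivAt_hamiltonian hm (h z hz)).continuousAt.continuousWithinAt
  · exact fun z hz => (hasDerivAt_hamiltonian hm
      (h z (interior_subset hz))).differentiableAt.differentiableWithinAt
  · intro z hz
    have hz' := h z (interior_subset hz)
    rw [(hasDerivAt_hamiltonian hm hz').deriv]
    have := hz'.r_pos
    have : 0 ≤ (m : ℝ) / (m + 1) * r z ^ (m + 1) := by positivity
    linarith

/-! ### A priori bounds from the Hamiltonian -/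

section bounds

variable {m : ℕ} {r θ : ℝ → ℝ} {z : ℝ}

lemma mul_le_mul_cos_of_hamiltonian_nonneg (hr : 0 < r z) (h0 : 0 ≤ hamiltonian m r θ z) :
    m * (z * r z) ≤ (m + 1) * Real.cos (θ z) := by
  have e : hamiltonian m r θ z
      = r z ^ m / (m + 1) * ((m + 1) * Real.cos (θ z) - m * (z * r z)) := by
    unfold hamiltonian; field_simp; ring
  rw [e] at h0
  have := nonneg_of_mul_nonneg_right h0 (by positivity)
  linarith

lemma mul_le_two_of_hamiltonian_nonneg (hm : 1 ≤ m) (hz : 0 < z) (hr : 0 < r z)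
    (h0 : 0 ≤ hamiltonian m r θ z) : z * r z ≤ 2 := by
  have h := mul_le_mul_cos_of_hamiltonian_nonneg hr h0
  have hc := Real.cos_le_one (θ z)
  have hm1 : (1 : ℝ) ≤ m := by exact_mod_cast hm
  have : 0 < z * r z := by positivity
  nlinarith

lemma mul_le_two_mul_cos_of_hamiltonian_nonneg (hm : 1 ≤ m) (hz : 0 < z) (hr : 0 < r z)
    (h0 : 0 ≤ hamiltonian m r θ z) : z * r z ≤ 2 * Real.cos (θ z) := by
  have h := mul_le_mul_cos_of_hamiltonian_nonneg hr h0
  have hm1 : (1 : ℝ) ≤ m := by exact_mod_cast hm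
  have hu : 0 < z * r z := by positivity
  have hc : 0 < Real.cos (θ z) := by
    have : 0 < m * (z * r z) := by positivity
    exact pos_of_mul_pos_right (this.trans_le h) (by positivity)
  have : m * (z * r z) ≤ m * (2 * Real.cos (θ z)) := by nlinarith
  exact le_of_mul_le_mul_left this (by linarith)

lemma le_of_le_hamiltonian (hm : 1 ≤ m) (hz : 0 < z) (hr : 0 < r z) {b : ℝ} (hb : b ≤ 1)
    (h : b ≤ hamiltonian m r θ z) : b ≤ r z := by
  by_contra! hlt
  have h1 : r z < 1 := hlt.trans_le hb
  have h2 : r z ^ m ≤ r z := pow_le_of_le_one hr.le h1.le (by omega)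
  have h3 : r z ^ m * Real.cos (θ z) ≤ r z ^ m * 1 := by
    gcongr; exact Real.cos_le_one _
  have h4 : 0 ≤ (m : ℝ) / (m + 1) * (z * r z ^ (m + 1)) := by positivity
  unfold hamiltonian at h
  linarith

end bounds

/-! ### Growth of the energy gap -/

/-- The gap `g` of the corrected energy satisfies `g' ≥ κ * g / z - O(1 / z ^ 3)`. Subtracting `C /
z ^ 2` absorbs the error and `z ^ (-κ)` is the integrating factor. -/
lemma exists_correctedEnergy_comparison (m : ℕ) (hm : 1 ≤ m) :
    ∃ ε C κ : ℝ, 0 < κ ∧ 0 < C ∧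
      (∀ r θ : ℝ → ℝ, ∀ z, CapillaryAt m r θ z → 0 ≤ hamiltonian m r θ z →
        |energy m (z * r z) (Real.cos (θ z)) - correctedEnergy m ε r θ z| ≤ C / z ^ 2) ∧
      ∀ r θ : ℝ → ℝ, ∀ a b : ℝ, a ≤ b →
        (∀ z ∈ Icc a b, CapillaryAt m r θ z ∧ 0 ≤ hamiltonian m r θ z) →
        a ^ (-κ) * (1 / (m + 1) - correctedEnergy m ε r θ a - C / a ^ 2)
          ≤ b ^ (-κ) * (1 / (m + 1) - correctedEnergy m ε r θ b - C / b ^ 2) := by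
  set ε : ℝ := (1 / 4) ^ m / 4 with hε
  have hε0 : 0 < ε := by positivity
  have hε1 : ε ≤ 1 / 4 := by
    have : (1 / 4 : ℝ) ^ m ≤ 1 := pow_le_one₀ (by norm_num) (by norm_num)
    rw [hε]; linarith
  have hm1 : (1 : ℝ) ≤ m := by exact_mod_cast hm
  -- `A` bounds the numerators of both the correction and the cubic remainder, because `z * r z ≤
  -- 2`. The barrier uses `2 * A`, whose derivative dominates both errors.
  set A : ℝ := m * 2 ^ (m + 1) + 2 with hA
  have hA0 : 0 < A := by positivity
  have small : ∀ (r θ : ℝ → ℝ) z, CapillaryAt m r θ z → 0 ≤ hamiltonian m r θ z →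
      |(z * r z) ^ (m + 1) * Real.sin (θ z)| ≤ 2 ^ (m + 1) ∧ |(z * r z) * Real.sin (θ z)| ≤ 2 := by
    intro r θ z h h0
    have hu := mul_le_two_of_hamiltonian_nonneg hm h.z_pos h.r_pos h0
    have hu0 : 0 < z * r z := mul_pos h.z_pos h.r_pos
    have hs := Real.abs_sin_le_one (θ z)
    rw [abs_mul, abs_mul, abs_of_pos hu0, abs_of_pos (pow_pos hu0 _)]
    constructor
    · calc (z * r z) ^ (m + 1) * |Real.sin (θ z)| ≤ 2 ^ (m + 1) * 1 := by gcongr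
        _ = _ := mul_one _
    · calc (z * r z) * |Real.sin (θ z)| ≤ 2 * 1 := by gcongr
        _ = _ := mul_one _
  have close : ∀ r θ : ℝ → ℝ, ∀ z, CapillaryAt m r θ z → 0 ≤ hamiltonian m r θ z →
        |energy m (z * r z) (Real.cos (θ z)) - correctedEnergy m ε r θ z| ≤ A / z ^ 2 := by
    intro r θ z h h0
    obtain ⟨h1, h2⟩ := small r θ z h h0
    have hz := h.z_pos
    unfold correctedEnergy
    rw [sub_add_cancel_left, abs_neg, abs_div, abs_of_pos (pow_pos hz 2)]
    gcongr
    rw [abs_le] at *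
    have : (2 : ℝ) ^ (m + 1) ≤ m * 2 ^ (m + 1) := by
      have : (0 : ℝ) < 2 ^ (m + 1) := by positivity
      nlinarith
    constructor <;> nlinarith
  refine ⟨ε, 2 * A, ε / 8, by positivity, by positivity, ?_, ?_⟩
  · intro r θ z h h0
    refine (close r θ z h h0).trans ?_
    gcongr
    linarith
  intro r θ a b hab h
  set κ := ε / 8 with hκ
  have key : MonotoneOn (fun z => z ^ (-κ) *
      (1 / (m + 1) - correctedEnergy m ε r θ z - 2 * A / z ^ 2)) (Icc a b) := by
    have hd : ∀ z ∈ Icc a b, HasDerivAt (fun z => z ^ (-κ) *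
      (1 / (m + 1) - correctedEnergy m ε r θ z - 2 * A / z ^ 2))
      (1 * -κ * z ^ (-κ - 1) * (1 / (m + 1) - correctedEnergy m ε r θ z - 2 * A / z ^ 2)
        + z ^ (-κ) * (-(dissipation m ε (z * r z) (Real.cos (θ z)) / z
        + ((1 - ε) * (m - 1) * ((z * r z) ^ (m + 1) * Real.sin (θ z))
          - ε * ((z * r z) * Real.sin (θ z))) / z ^ 3) - (-(2 * A * (2 * z))) / (z ^ 2) ^ 2)) z := by
      intro z hz
      have hz0 := (h z hz).1.z_pos
      have h1 := ((hasDerivAt_id z).rpow_const (p := -κ) (Or.inl hz0.ne'))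
      have h2 := (hasDerivAt_correctedEnergy hm ε (h z hz).1).const_sub (1 / ((m : ℝ) + 1))
      have h3 := (hasDerivAt_const z (2 * A)).fun_div (hasDerivAt_pow 2 z) (by positivity)
      refine (h1.fun_mul (h2.fun_sub h3)).congr_deriv ?_
      simp only [id]
      norm_num
    apply monotoneOn_of_deriv_nonneg (convex_Icc a b)
    · exact fun z hz => (hd z hz).continuousAt.continuousWithinAt
    · exact fun z hz => (hd z (interior_subset hz)).differentiableAt.differentiableWithinAt
    · intro z hz
      have hz := interior_subset hz
      rw [(hd z hz).deriv]
      obtain ⟨hcap, h0⟩ := h z hz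
      have hz0 := hcap.z_pos
      have hr0 := hcap.r_pos
      obtain ⟨h1, h2⟩ := small r θ z hcap h0
      have h3 := close r θ z hcap h0
      have h4 := dissipation_le m hm (mul_pos hz0 hr0) hcap.cos_pos (Real.cos_le_one _)
        (mul_le_mul_cos_of_hamiltonian_nonneg hr0 h0) hε
      rw [Real.rpow_sub_one hz0.ne']
      set D := dissipation m ε (z * r z) (Real.cos (θ z))
      set V := correctedEnergy m ε r θ z
      set X := (z * r z) ^ (m + 1) * Real.sin (θ z)
      set X' := (z * r z) * Real.sin (θ z)
      set e := energy m (z * r z) (Real.cos (θ z))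
      have hR : (1 - ε) * (m - 1) * X - ε * X' ≤ A := by
        have hx1 : X ≤ 2 ^ (m + 1) := (le_abs_self _).trans h1
        have hx2 : -X' ≤ 2 := (neg_le_abs _).trans h2
        have hp : 0 ≤ (1 - ε) * ((m : ℝ) - 1) := mul_nonneg (by linarith) (by linarith)
        have hq : (1 - ε) * ((m : ℝ) - 1) ≤ m := by nlinarith
        calc (1 - ε) * (m - 1) * X - ε * X' = (1 - ε) * (m - 1) * X + ε * (-X') := by ring
          _ ≤ (1 - ε) * (m - 1) * 2 ^ (m + 1) + ε * 2 := by gcongr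
          _ ≤ m * 2 ^ (m + 1) + 1 * 2 := by gcongr; linarith
          _ = A := by rw [hA]; ring
      have hk1 : κ ≤ 1 := by rw [hκ]; linarith
      have hk0 : 0 < κ := by positivity
      have e1 : 1 * -κ * (z ^ (-κ) / z) * (1 / (m + 1) - V - 2 * A / z ^ 2)
        + z ^ (-κ) * (-(D / z + ((1 - ε) * (m - 1) * X - ε * X') / z ^ 3)
          - (-(2 * A * (2 * z))) / (z ^ 2) ^ 2)
        = z ^ (-κ) / z * (-κ * (1 / (m + 1) - V) - D
          + (2 * A * κ + 4 * A - ((1 - ε) * (m - 1) * X - ε * X')) / z ^ 2) := by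
        field_simp
        ring
      rw [e1]
      have hpow : 0 < z ^ (-κ) := Real.rpow_pos_of_pos hz0 _
      apply mul_nonneg (by positivity)
      have h5 : e - V ≤ A / z ^ 2 := (le_abs_self _).trans h3
      have h6 : κ * (e - V) ≤ A / z ^ 2 := by
        calc κ * (e - V) ≤ κ * (A / z ^ 2) := by gcongr
          _ ≤ 1 * (A / z ^ 2) := by gcongr
          _ = _ := one_mul _
      have h7 : A / z ^ 2 ≤ (2 * A * κ + 4 * A - ((1 - ε) * (m - 1) * X - ε * X')) / z ^ 2 := by
        gcongr
        nlinarith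
      rw [← hκ] at h4
      linarith
  exact key (left_mem_Icc.2 hab) (right_mem_Icc.2 hab) hab

/-- Solutions of positive energy have almost maximal energy at height `z`, provided they extend far
enough to the right. -/
lemma exists_energy_gap_bound (m : ℕ) (hm : 1 ≤ m) :
    ∃ C : ℝ, 0 < C ∧
      (∀ r θ : ℝ → ℝ, (∀ z, 0 < z → CapillaryAt m r θ z ∧ 0 ≤ hamiltonian m r θ z) →
        ∀ z, 0 < z → 1 / (m + 1) - energy m (z * r z) (Real.cos (θ z)) ≤ C / z ^ 2) ∧
      ∀ r θ : ℝ → ℝ, ∀ a b : ℝ, a ≤ b →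
        (∀ z ∈ Icc a b, CapillaryAt m r θ z ∧ 0 ≤ hamiltonian m r θ z) →
        r b = 1 / b → θ b = 0 →
        1 / (m + 1) - energy m (a * r a) (Real.cos (θ a)) ≤ C / a ^ 2 := by
  obtain ⟨ε, C, κ, hκ, hC, close, cmp⟩ := exists_correctedEnergy_comparison m hm
  have fin : ∀ r θ : ℝ → ℝ, ∀ z, CapillaryAt m r θ z → 0 ≤ hamiltonian m r θ z →
      z ^ (-κ) * (1 / (m + 1) - correctedEnergy m ε r θ z - C / z ^ 2) ≤ 0 →
      1 / (m + 1) - energy m (z * r z) (Real.cos (θ z)) ≤ 2 * C / z ^ 2 := by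
    intro r θ z h h0 hle
    have h1 := nonpos_of_mul_nonpos_right hle (Real.rpow_pos_of_pos h.z_pos _)
    have h2 := (abs_le.1 (close r θ z h h0)).1
    rw [mul_div_assoc]
    linarith
  refine ⟨2 * C, by positivity, ?_, ?_⟩
  · intro r θ h z hz
    refine fin r θ z (h z hz).1 (h z hz).2 ?_
    -- The gap is at most `1`, so the right end of the comparison tends to `0` with `b ^ (-κ)`.
    have hlim : Tendsto (fun b : ℝ => b ^ (-κ)) atTop (𝓝 0) := tendsto_rpow_neg_atTop hκ
    refine ge_of_tendsto hlim ?_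
    filter_upwards [eventually_ge_atTop z] with b hb
    have hb0 : 0 < b := hz.trans_le hb
    refine (cmp r θ z b hb fun w hw => h w (hz.trans_le hw.1)).trans ?_
    have h2 := (abs_le.1 (close r θ b (h b hb0).1 (h b hb0).2)).2
    have h3 : 0 ≤ energy m (b * r b) (Real.cos (θ b)) := by
      rw [energy_eq_hamiltonian]
      exact mul_nonneg (by positivity) (h b hb0).2
    have h4 : 1 / ((m : ℝ) + 1) ≤ 1 := by
      rw [div_le_one (by positivity)]; linarith [(Nat.cast_nonneg m : (0 : ℝ) ≤ m)]
    exact mul_le_of_le_one_right (Real.rpow_nonneg hb0.le _) (by linarith)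
  · intro r θ a b hab h hrb hθb
    obtain ⟨ha, ha0⟩ := h a (left_mem_Icc.2 hab)
    have hb0 : 0 < b := ha.z_pos.trans_le hab
    refine fin r θ a ha ha0 ((cmp r θ a b hab h).trans ?_)
    apply mul_nonpos_of_nonneg_of_nonpos (Real.rpow_nonneg hb0.le _)
    -- At `u = 1`, `θ = 0` the energy is maximal and the correction vanishes.
    have : correctedEnergy m ε r θ b = 1 / (m + 1) := by
      unfold correctedEnergy energy
      rw [hrb, hθb, mul_one_div_cancel hb0.ne']
      simp
      field_simp
      ring
    rw [this]
    have : 0 ≤ C / b ^ 2 := by positivity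
    linarith

/-! ### First-order asymptotics of global solutions -/

section global

variable {m : ℕ} {r θ : ℝ → ℝ}

/-- If `H ≤ -b < 0` from some height on, then `b ≤ w * r w ^ (m + 1)`, so `1 / r` is at most `w / 2`
for large `w` and `θ' ≥ 1`. Over a length `4 > π` this is impossible. -/
lemma hamiltonian_nonneg_of_global (hm : 1 ≤ m) (h : ∀ z, 0 < z → CapillaryAt m r θ z) {z : ℝ}
    (hz : 0 < z) : 0 ≤ hamiltonian m r θ z := by
  by_contra! hneg
  set b := -hamiltonian m r θ z with hb
  have hb0 : 0 < b := by linarith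
  have hm1 : (1 : ℝ) ≤ m := by exact_mod_cast hm
  -- If `r w < 2 / w` with `w ≥ 2`, then `b ≤ w * (2 / w) ^ 2 = 4 / w`; the bound `4 / b + 1`
  -- excludes this.
  set z₁ := max z (max 2 (4 / b + 1)) with hz₁
  have hge : ∀ w, z₁ ≤ w → 1 ≤ (m : ℝ) * (w / Real.cos (θ w) - 1 / r w) := by
    intro w hw
    have hwz : z ≤ w := (le_max_left _ _).trans hw
    have hw2 : 2 ≤ w := (le_max_left _ _).trans ((le_max_right _ _).trans hw)
    have hwb : 4 / b + 1 ≤ w := (le_max_right _ _).trans ((le_max_right _ _).trans hw)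
    have hw0 : 0 < w := by linarith
    have hcap := h w hw0
    have hr := hcap.r_pos
    have hc := hcap.cos_pos
    have hanti := antitoneOn_hamiltonian hm (convex_Ioi (0 : ℝ)) h hz hw0 hwz
    have h1 : b ≤ w * r w ^ (m + 1) := by
      have e1 : 0 ≤ r w ^ m * Real.cos (θ w) := by positivity
      have e2 : (m : ℝ) / (m + 1) * (w * r w ^ (m + 1)) ≤ 1 * (w * r w ^ (m + 1)) := by
        gcongr
        rw [div_le_one (by positivity)]
        linarith
      have e3 : hamiltonian m r θ w
        = r w ^ m * Real.cos (θ w) - m / (m + 1) * (w * r w ^ (m + 1)) := rfl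
      linarith
    have h2 : 1 / r w ≤ w / 2 := by
      by_contra! hlt
      have h3 : r w < 2 / w := by
        rw [div_lt_div_iff₀ (by norm_num) hr] at hlt
        rw [lt_div_iff₀ hw0]
        linarith
      have h4 : r w ^ (m + 1) ≤ (2 / w) ^ 2 := by
        calc r w ^ (m + 1) ≤ (2 / w) ^ (m + 1) := by gcongr
          _ ≤ (2 / w) ^ 2 := by
            apply pow_le_pow_of_le_one (by positivity)
            · rw [div_le_one hw0]; exact hw2
            · omega
      have h5 : b ≤ w * (2 / w) ^ 2 := h1.trans (by gcongr)
      have h6 : w * (2 / w) ^ 2 = 4 / w := by field_simp; norm_num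
      rw [h6, le_div_iff₀ hw0] at h5
      have h7 : 4 / b < w := by linarith
      rw [div_lt_iff₀ hb0] at h7
      linarith
    have h8 : w ≤ w / Real.cos (θ w) := by
      rw [le_div_iff₀ hc]
      have := Real.cos_le_one (θ w)
      nlinarith
    have h9 : 1 ≤ w / Real.cos (θ w) - 1 / r w := by linarith
    nlinarith
  have hz₁0 : 0 < z₁ := hz.trans_le (le_max_left _ _)
  have hmono : MonotoneOn (fun w => θ w - w) (Icc z₁ (z₁ + 4)) := by
    have hd : ∀ w ∈ Icc z₁ (z₁ + 4), HasDerivAt (fun w => θ w - w)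
        ((m : ℝ) * (w / Real.cos (θ w) - 1 / r w) - 1) w := fun w hw =>
      (h w (hz₁0.trans_le hw.1)).deriv_theta.fun_sub (hasDerivAt_id w)
    apply monotoneOn_of_deriv_nonneg (convex_Icc _ _)
    · exact fun w hw => (hd w hw).continuousAt.continuousWithinAt
    · exact fun w hw => (hd w (interior_subset hw)).differentiableAt.differentiableWithinAt
    · intro w hw
      rw [(hd w (interior_subset hw)).deriv]
      linarith [hge w (interior_subset hw).1]
  have h1 := hmono (left_mem_Icc.2 (by linarith)) (right_mem_Icc.2 (by linarith))
    (show z₁ ≤ z₁ + 4 by linarith)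
  have h2 := (h z₁ hz₁0).theta_mem.1
  have h3 := (h (z₁ + 4) (by linarith)).theta_mem.2
  have h4 := Real.pi_lt_four
  simp only at h1
  linarith

lemma tendsto_const_div_pow_atTop (C : ℝ) {k : ℕ} (hk : k ≠ 0) :
    Tendsto (fun z : ℝ => C / z ^ k) atTop (𝓝 0) :=
  tendsto_const_nhds.div_atTop (tendsto_pow_atTop hk)

lemma tendsto_mul_of_global (hm : 1 ≤ m) (h : ∀ z, 0 < z → CapillaryAt m r θ z) :
    Tendsto (fun z => z * r z) atTop (𝓝 1) := by
  obtain ⟨C, hC, hgap, -⟩ := exists_energy_gap_bound m hm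
  have hg := hgap r θ fun z hz => ⟨h z hz, hamiltonian_nonneg_of_global hm h hz⟩
  have hsq : Tendsto (fun z => (z * r z - 1) ^ 2) atTop (𝓝 0) := by
    refine tendsto_of_tendsto_of_tendsto_of_le_of_le' tendsto_const_nhds
      (tendsto_const_div_pow_atTop ((m + 1) * C) two_ne_zero) (Eventually.of_forall fun z => sq_nonneg _) ?_
    filter_upwards [eventually_gt_atTop 0] with z hz
    have hu : 0 < z * r z := mul_pos hz (h z hz).r_pos
    have h1 := le_energy_gap m hm hu.le (Real.cos (θ z))
    have h2 : 0 ≤ (z * r z) ^ m * (1 - Real.cos (θ z)) :=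
      mul_nonneg (by positivity) (by linarith [Real.cos_le_one (θ z)])
    have h3 : (z * r z - 1) ^ 2 / (m + 1) ≤ C / z ^ 2 := by linarith [hg z hz]
    rw [div_le_iff₀ (by positivity)] at h3
    calc (z * r z - 1) ^ 2 ≤ C / z ^ 2 * (m + 1) := h3
      _ = _ := by ring
  have h1 : Tendsto (fun z => |z * r z - 1|) atTop (𝓝 0) := by
    have := hsq.sqrt
    simpa [Real.sqrt_sq_eq_abs] using this
  have h2 := (tendsto_zero_iff_abs_tendsto_zero _).2 h1
  simpa using h2.add_const 1

lemma tendsto_cos_of_global (hm : 1 ≤ m) (h : ∀ z, 0 < z → CapillaryAt m r θ z) :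
    Tendsto (fun z => Real.cos (θ z)) atTop (𝓝 1) := by
  obtain ⟨C, hC, hgap, -⟩ := exists_energy_gap_bound m hm
  have hg := hgap r θ fun z hz => ⟨h z hz, hamiltonian_nonneg_of_global hm h hz⟩
  have hu1 := tendsto_mul_of_global hm h
  have hlim : Tendsto (fun z => C / z ^ 2 / (z * r z) ^ m) atTop (𝓝 0) := by
    have : Tendsto (fun z => C / z ^ 2 / (z * r z) ^ m) atTop (𝓝 (0 / 1 ^ m)) :=
      (tendsto_const_div_pow_atTop C two_ne_zero).div (hu1.pow m) (by simp)
    simpa using this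
  have hlow : Tendsto (fun z => 1 - C / z ^ 2 / (z * r z) ^ m) atTop (𝓝 1) := by
    simpa using hlim.const_sub 1
  refine tendsto_of_tendsto_of_tendsto_of_le_of_le' hlow tendsto_const_nhds ?_
    (Eventually.of_forall fun z => Real.cos_le_one _)
  filter_upwards [eventually_gt_atTop 0] with z hz
  have hu : 0 < z * r z := mul_pos hz (h z hz).r_pos
  have h1 := le_energy_gap m hm hu.le (Real.cos (θ z))
  have h2 : 0 ≤ (z * r z - 1) ^ 2 / ((m : ℝ) + 1) := by positivity
  have h3 : 1 - Real.cos (θ z) ≤ C / z ^ 2 / (z * r z) ^ m := by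
    rw [le_div_iff₀ (by positivity)]
    linarith [hg z hz]
  linarith

lemma tendsto_theta_of_global (hm : 1 ≤ m) (h : ∀ z, 0 < z → CapillaryAt m r θ z) :
    Tendsto θ atTop (𝓝 0) := by
  rw [tendsto_zero_iff_abs_tendsto_zero]
  have h1 := (Real.continuous_arccos.tendsto 1).comp (tendsto_cos_of_global hm h)
  rw [Real.arccos_one] at h1
  refine h1.congr' ?_
  filter_upwards [eventually_gt_atTop 0] with z hz
  obtain ⟨h2, h3⟩ := (h z hz).theta_mem
  simp only [Function.comp]
  rw [← Real.cos_abs, Real.arccos_cos (abs_nonneg _)]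
  rw [abs_le]
  constructor <;> linarith [Real.pi_pos]

end global

/-! ### Second-order asymptotics and the sign of the angle -/

lemma eventually_nonpos_of_deriv_nonneg {f f' : ℝ → ℝ} (hf : ∀ᶠ z in atTop, HasDerivAt f (f' z) z)
    (hf' : ∀ᶠ z in atTop, 0 ≤ f' z) (hlim : Tendsto f atTop (𝓝 0)) : ∀ᶠ z in atTop, f z ≤ 0 := by
  obtain ⟨a, ha⟩ := eventually_atTop.1 (hf.and hf')
  have hmono : MonotoneOn f (Ici a) := by
    apply monotoneOn_of_deriv_nonneg (convex_Ici _)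
    · exact fun w hw => (ha w hw).1.continuousAt.continuousWithinAt
    · exact fun w hw => (ha w (interior_subset hw)).1.differentiableAt.differentiableWithinAt
    · intro w hw
      rw [(ha w (interior_subset hw)).1.deriv]
      exact (ha w (interior_subset hw)).2
  filter_upwards [eventually_ge_atTop a] with z hz
  refine ge_of_tendsto hlim ?_
  filter_upwards [eventually_ge_atTop z] with w hw
  exact hmono hz (hz.trans hw) hw

lemma eventually_neg_le_quadratic {α β γ x : ℝ → ℝ} {K δ : ℝ} (hδ : 0 < δ)
    (hx : ∀ᶠ z in atTop, |x z| ≤ K) (hα : Tendsto α atTop (𝓝 0)) (hβ : Tendsto β atTop (𝓝 0))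
    (hγ : Tendsto γ atTop (𝓝 0)) :
    ∀ᶠ z in atTop, -δ ≤ α z * x z ^ 2 + β z * x z + γ z := by
  have h1 : Tendsto (fun z => |α z| * K ^ 2 + |β z| * K + |γ z|) atTop (𝓝 0) := by
    simpa using ((hα.abs.mul_const (K ^ 2)).add (hβ.abs.mul_const K)).add hγ.abs
  filter_upwards [hx, h1.eventually_lt_const hδ] with z hz hlt
  have e1 : |α z * x z ^ 2| ≤ |α z| * K ^ 2 := by
    rw [abs_mul, abs_pow]
    gcongr
  have e2 : |β z * x z| ≤ |β z| * K := by
    rw [abs_mul]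
    gcongr
  have := neg_abs_le (α z * x z ^ 2)
  have := neg_abs_le (β z * x z)
  have := neg_abs_le (γ z)
  linarith

section global

variable {m : ℕ} {r θ : ℝ → ℝ}

/-- The energy gap, corrected so that it vanishes to leading order along the expected expansion
`z * r z ≈ 1`, `sin (θ z) ≈ 1 / z ^ 2`. -/
noncomputable def correctedGap (m : ℕ) (r θ : ℝ → ℝ) (z : ℝ) : ℝ :=
  1 / (m + 1) - correctedEnergy m 0 r θ z + 1 / 2 / z ^ 4

lemma hasDerivAt_const_div_pow_four (C : ℝ) {z : ℝ} (hz : 0 < z) :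
    HasDerivAt (fun z : ℝ => C / z ^ 4) (-(4 * C) / z ^ 5) z := by
  refine ((hasDerivAt_const z C).fun_div (hasDerivAt_pow 4 z) (by positivity)).congr_deriv ?_
  norm_num
  field_simp

lemma hasDerivAt_correctedGap (hm : 1 ≤ m) {z : ℝ} (h : CapillaryAt m r θ z) :
    HasDerivAt (correctedGap m r θ)
      (((m + 1) * (z * r z) ^ m * (z ^ 2 * Real.sin (θ z)) ^ 2 / Real.cos (θ z)
        - (m - 1) * (z * r z) ^ (m + 1) * (z ^ 2 * Real.sin (θ z)) - 2) / z ^ 5) z := by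
  have hz := h.z_pos
  have hc := h.cos_pos
  refine (((hasDerivAt_correctedEnergy hm 0 h).const_sub (1 / ((m : ℝ) + 1))).fun_add
    (hasDerivAt_const_div_pow_four (1 / 2) hz)).congr_deriv ?_
  unfold dissipation
  rw [← Real.sin_sq]
  field_simp
  ring

/-- With `x = z ^ 2 * sin θ` and `u` near `1`, the lower bound is close to `(x - 1) ^ 2 / 2`, so an
upper bound on the corrected gap controls `x`. -/
lemma pow_four_mul_correctedGap_ge (hm : 1 ≤ m) {z : ℝ} (h : CapillaryAt m r θ z) :
    (z * r z) ^ m * (z ^ 2 * Real.sin (θ z)) ^ 2 / 2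
      - (z * r z) ^ (m + 1) * (z ^ 2 * Real.sin (θ z)) + 1 / 2 ≤ z ^ 4 * correctedGap m r θ z := by
  have hz := h.z_pos
  have hu : 0 < z * r z := mul_pos hz h.r_pos
  have h1 := le_energy_gap m hm hu.le (Real.cos (θ z))
  have h2 : 0 ≤ (z * r z - 1) ^ 2 / ((m : ℝ) + 1) := by positivity
  have hs : Real.sin (θ z) ^ 2 / 2 ≤ 1 - Real.cos (θ z) := by
    rw [Real.sin_sq]
    nlinarith [sq_nonneg (1 - Real.cos (θ z))]
  have h3 : (z * r z) ^ m * (Real.sin (θ z) ^ 2 / 2) ≤ (z * r z) ^ m * (1 - Real.cos (θ z)) := by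
    gcongr
  have h4 : z ^ 4 * ((z * r z) ^ m * (Real.sin (θ z) ^ 2 / 2))
      ≤ z ^ 4 * (1 / (m + 1) - energy m (z * r z) (Real.cos (θ z))) := by
    gcongr
    linarith
  have e : z ^ 4 * correctedGap m r θ z
      = z ^ 4 * (1 / (m + 1) - energy m (z * r z) (Real.cos (θ z)))
        - (z * r z) ^ (m + 1) * (z ^ 2 * Real.sin (θ z)) + 1 / 2 := by
    unfold correctedGap correctedEnergy
    field_simp
    ring
  rw [e]
  nlinarith

lemma tendsto_correctedGap (hm : 1 ≤ m) (h : ∀ z, 0 < z → CapillaryAt m r θ z) :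
    Tendsto (correctedGap m r θ) atTop (𝓝 0) := by
  have hu := tendsto_mul_of_global hm h
  have hc := tendsto_cos_of_global hm h
  have hs : Tendsto (fun z => Real.sin (θ z)) atTop (𝓝 0) := by
    simpa [Function.comp_def] using
      (Real.continuous_sin.tendsto 0).comp (tendsto_theta_of_global hm h)
  have h1 : Tendsto (fun z : ℝ => 1 / z ^ 2) atTop (𝓝 0) :=
    tendsto_const_div_pow_atTop 1 two_ne_zero
  have h2 : Tendsto (fun z : ℝ => 1 / 2 / z ^ 4) atTop (𝓝 0) :=
    tendsto_const_div_pow_atTop _ four_ne_zero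
  have hE := ((((hu.pow m).mul hc).sub ((hu.pow (m + 1)).const_mul ((m : ℝ) / (m + 1)))).add
    ((((((hu.pow (m + 1)).mul hs).const_mul (1 - 0)).add ((hu.mul hs).const_mul 0))).mul h1))
  have := (hE.const_sub (1 / ((m : ℝ) + 1))).add h2
  convert this using 2
  · unfold correctedGap correctedEnergy energy
    ring
  · simp
    field_simp
    ring

lemma exists_bound_sq_mul_sin (hm : 1 ≤ m) (h : ∀ z, 0 < z → CapillaryAt m r θ z) :
    ∃ K, ∀ᶠ z in atTop, |z ^ 2 * Real.sin (θ z)| ≤ K := by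
  have hu := tendsto_mul_of_global hm h
  have hm1 : (1 : ℝ) ≤ m := by exact_mod_cast hm
  have hum : ∀ᶠ z in atTop, 1 / 2 < (z * r z) ^ m :=
    (hu.pow m).eventually_const_lt (by norm_num)
  have hum1 : ∀ᶠ z in atTop, (z * r z) ^ (m + 1) < 2 :=
    (hu.pow (m + 1)).eventually_lt_const (by norm_num)
  -- `4 * K₀ = (m - 1) ^ 2 + 2` completes the square in `x ^ 2 - 2 * (m - 1) * |x| - 2`, a lower
  -- bound for the numerator of the derivative of the gap.
  set K₀ : ℝ := ((m - 1) ^ 2 + 2) / 4 with hK₀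
  have hneg : ∀ᶠ z in atTop, correctedGap m r θ z - K₀ / z ^ 4 ≤ 0 := by
    refine eventually_nonpos_of_deriv_nonneg (f' := fun z =>
      (((m + 1) * (z * r z) ^ m * (z ^ 2 * Real.sin (θ z)) ^ 2 / Real.cos (θ z)
        - (m - 1) * (z * r z) ^ (m + 1) * (z ^ 2 * Real.sin (θ z)) - 2) / z ^ 5)
        - (-(4 * K₀) / z ^ 5)) ?_ ?_ ?_
    · filter_upwards [eventually_gt_atTop 0] with z hz
      exact (hasDerivAt_correctedGap hm (h z hz)).fun_sub (hasDerivAt_const_div_pow_four K₀ hz)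
    · filter_upwards [eventually_gt_atTop 0, hum, hum1] with z hz h1 h2
      have hc := (h z hz).cos_pos
      have hc1 := Real.cos_le_one (θ z)
      have hu0 : 0 < z * r z := mul_pos hz (h z hz).r_pos
      have hp : 0 < (z * r z) ^ (m + 1) := by positivity
      generalize (z * r z) ^ (m + 1) = p at *
      generalize (z * r z) ^ m = q at *
      generalize z ^ 2 * Real.sin (θ z) = x at *
      rw [← sub_div]
      apply div_nonneg _ (by positivity)
      have e1 : x ^ 2 ≤ (m + 1) * q * x ^ 2 / Real.cos (θ z) := by
        rw [le_div_iff₀ hc]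
        have : x ^ 2 * Real.cos (θ z) ≤ x ^ 2 * 1 := by gcongr
        have : 1 * x ^ 2 ≤ (m + 1) * q * x ^ 2 := by
          gcongr
          nlinarith
        linarith
      have e2 : (m - 1) * p * x ≤ (m - 1) * 2 * |x| := by
        have : 0 ≤ (m : ℝ) - 1 := by linarith
        calc (m - 1) * p * x ≤ (m - 1) * p * |x| := by gcongr; exact le_abs_self x
          _ ≤ _ := by gcongr
      have e3 := sq_nonneg (|x| - (m - 1))
      have e4 := sq_abs x
      nlinarith
    · simpa using (tendsto_correctedGap hm h).sub (tendsto_const_div_pow_atTop K₀ four_ne_zero)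
  refine ⟨9 + 4 * K₀, ?_⟩
  filter_upwards [eventually_gt_atTop 0, hum, hum1, hneg] with z hz h1 h2 h3
  have hu0 : 0 < z * r z := mul_pos hz (h z hz).r_pos
  have hp : 0 < (z * r z) ^ (m + 1) := by positivity
  have h4 := pow_four_mul_correctedGap_ge hm (h z hz)
  have h5 : z ^ 4 * correctedGap m r θ z ≤ K₀ := by
    have : correctedGap m r θ z ≤ K₀ / z ^ 4 := by linarith
    rw [le_div_iff₀ (by positivity)] at this
    linarith
  generalize (z * r z) ^ (m + 1) = p at *
  generalize (z * r z) ^ m = q at *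
  generalize z ^ 2 * Real.sin (θ z) = x at *
  have hK : 0 ≤ K₀ := by positivity
  have e1 : 1 / 2 * x ^ 2 ≤ q * x ^ 2 := by gcongr
  have e2 : p * x ≤ 2 * |x| := by
    calc p * x ≤ p * |x| := by gcongr; exact le_abs_self x
      _ ≤ _ := by gcongr
  rw [← sq_abs] at *
  have e3 := abs_nonneg x
  by_contra! hlt
  nlinarith

/-- Put `x = z ^ 2 * sin θ`, now known to be bounded. Adding `(m + 3) * (u - 1) / z ^ 4` to the gap
turns the leading numerator `(m + 1) * x ^ 2 - (m - 1) * x - 2` of its derivative into `(m + 1) * (x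
- 1) ^ 2`. Hence `z ^ 4` times the gap is eventually at most `1 / 8 + o(1)`, whereas `x ≤ 0` would
make it at least `1 / 2 - o(1)`. -/
lemma eventually_sin_pos (hm : 1 ≤ m) (h : ∀ z, 0 < z → CapillaryAt m r θ z) :
    ∀ᶠ z in atTop, 0 < Real.sin (θ z) := by
  obtain ⟨K, hK⟩ := exists_bound_sq_mul_sin hm h
  have hu := tendsto_mul_of_global hm h
  have hc := tendsto_cos_of_global hm h
  have hu0 : Tendsto (fun z => z * r z - 1) atTop (𝓝 0) := by simpa using hu.sub_const 1
  have hum : Tendsto (fun z => (z * r z) ^ m - 1) atTop (𝓝 0) := by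
    simpa using (hu.pow m).sub_const 1
  have hum1 : Tendsto (fun z => (z * r z) ^ (m + 1) - 1) atTop (𝓝 0) := by
    simpa using (hu.pow (m + 1)).sub_const 1
  have hci : Tendsto (fun z => 1 / Real.cos (θ z) - 1) atTop (𝓝 0) := by
    simpa using (hc.inv₀ one_ne_zero).sub_const 1
  have humc : Tendsto (fun z => (z * r z) ^ m / Real.cos (θ z) - 1) atTop (𝓝 0) := by
    simpa using ((hu.pow m).div hc one_ne_zero).sub_const 1
  have hα : Tendsto (fun z => ((m : ℝ) + 1) * ((z * r z) ^ m / Real.cos (θ z) - 1)) atTop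
      (𝓝 0) := by
    simpa using humc.const_mul ((m : ℝ) + 1)
  have hβ : Tendsto (fun z => -((m : ℝ) - 1) * ((z * r z) ^ (m + 1) - 1)
      - (m + 3) * (1 / Real.cos (θ z) - 1)) atTop (𝓝 0) := by
    simpa using (hum1.const_mul (-((m : ℝ) - 1))).sub (hci.const_mul ((m : ℝ) + 3))
  have hγ : Tendsto (fun z => -3 * ((m : ℝ) + 3) * (z * r z - 1)) atTop (𝓝 0) := by
    simpa using hu0.const_mul (-3 * ((m : ℝ) + 3))
  have hγ' : Tendsto (fun z => ((m : ℝ) + 3) * (z * r z - 1)) atTop (𝓝 0) := by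
    simpa using hu0.const_mul ((m : ℝ) + 3)
  have hneg : ∀ᶠ z in atTop,
      correctedGap m r θ z + (m + 3) * ((z * r z - 1) / z ^ 4) - 1 / 8 / z ^ 4 ≤ 0 := by
    refine eventually_nonpos_of_deriv_nonneg (f' := fun z =>
      ((m + 1) * (z ^ 2 * Real.sin (θ z) - 1) ^ 2
        + ((m + 1) * ((z * r z) ^ m / Real.cos (θ z) - 1) * (z ^ 2 * Real.sin (θ z)) ^ 2
        + (-(m - 1) * ((z * r z) ^ (m + 1) - 1) - (m + 3) * (1 / Real.cos (θ z) - 1))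
          * (z ^ 2 * Real.sin (θ z)) + -3 * (m + 3) * (z * r z - 1)) + 1 / 2) / z ^ 5) ?_ ?_ ?_
    · filter_upwards [eventually_gt_atTop 0] with z hz
      have hcz := (h z hz).cos_pos
      refine (((hasDerivAt_correctedGap hm (h z hz)).fun_add
        ((((h z hz).hasDerivAt_mul.sub_const 1).fun_div (hasDerivAt_pow 4 z)
          (by positivity)).const_mul ((m : ℝ) + 3))).fun_sub
        (hasDerivAt_const_div_pow_four (1 / 8) hz)).congr_deriv ?_
      field_simp
      norm_num
      ring
    · filter_upwards [eventually_gt_atTop 0, eventually_neg_le_quadratic (δ := 1 / 2) (by norm_num)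
        hK hα hβ hγ] with z hz h1
      have : 0 ≤ (m + 1) * (z ^ 2 * Real.sin (θ z) - 1) ^ 2 := by positivity
      exact div_nonneg (by linarith) (by positivity)
    · have h1 : Tendsto (fun z : ℝ => 1 / z ^ 4) atTop (𝓝 0) :=
        tendsto_const_div_pow_atTop 1 four_ne_zero
      have h2 := ((tendsto_correctedGap hm h).add ((hu0.mul h1).const_mul ((m : ℝ) + 3))).sub
        (tendsto_const_div_pow_atTop (1 / 8) four_ne_zero)
      simpa [div_eq_mul_inv] using h2
  filter_upwards [eventually_gt_atTop 0, hneg, eventually_neg_le_quadratic (δ := 1 / 8)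
    (by norm_num) hK (by simpa using hum.div_const 2) (by simpa using hum1.neg) hγ'] with z hz h1 h2
  have h3 := pow_four_mul_correctedGap_ge hm (h z hz)
  have h4 : z ^ 4 * correctedGap m r θ z + (m + 3) * (z * r z - 1) ≤ 1 / 8 := by
    have e : z ^ 4 * (correctedGap m r θ z + (m + 3) * ((z * r z - 1) / z ^ 4) - 1 / 8 / z ^ 4)
        = z ^ 4 * correctedGap m r θ z + (m + 3) * (z * r z - 1) - 1 / 8 := by
      field_simp
    have := mul_nonpos_of_nonneg_of_nonpos (show 0 ≤ z ^ 4 by positivity) h1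
    linarith
  have hx : 0 < z ^ 2 * Real.sin (θ z) := by
    generalize z ^ 2 * Real.sin (θ z) = x at *
    by_contra! hle
    nlinarith
  exact pos_of_mul_pos_right hx (by positivity)

end global

/-! ### Backward uniqueness for the initial value problem -/

/-- The time-dependent vector field of the capillary system, on triples `(z, r, θ)`. -/
noncomputable def capillaryField (m : ℕ) (p : ℝ × ℝ × ℝ) : ℝ × ℝ :=
  (-Real.tan p.2.2, (m : ℝ) * (p.1 / Real.cos p.2.2 - 1 / p.2.1))

lemma exists_lipschitzOnWith_capillaryField (m : ℕ) (a b : ℝ) {ρ R Θ : ℝ} (hρ : 0 < ρ)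
    (hΘ : Θ < Real.pi / 2) :
    ∃ K, LipschitzOnWith K (capillaryField m) (Icc a b ×ˢ (Icc ρ R ×ˢ Icc (-Θ) Θ)) := by
  apply LocallyLipschitzOn.exists_lipschitzOnWith_of_compact
  · exact isCompact_Icc.prod (isCompact_Icc.prod isCompact_Icc)
  · rintro ⟨z, r, θ⟩ ⟨-, hr, hθ⟩
    have hc : Real.cos θ ≠ 0 :=
      (Real.cos_pos_of_mem_Ioo ⟨by linarith [hθ.1], by linarith [hθ.2]⟩).ne'
    have hr0 : r ≠ 0 := (hρ.trans_le hr.1).ne'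
    have h : ContDiffAt ℝ 1 (capillaryField m) (z, r, θ) := by
      have h1 : ContDiffAt ℝ 1 (fun p : ℝ × ℝ × ℝ => Real.tan p.2.2) (z, r, θ) :=
        ContDiffAt.comp (f := fun p : ℝ × ℝ × ℝ => p.2.2) (z, r, θ)
          (Real.contDiffAt_tan.2 hc) (by fun_prop)
      have h2 : ContDiffAt ℝ 1 (fun p : ℝ × ℝ × ℝ => p.1 / Real.cos p.2.2) (z, r, θ) :=
        ContDiffAt.div (by fun_prop) (by fun_prop) hc
      have h3 : ContDiffAt ℝ 1 (fun p : ℝ × ℝ × ℝ => 1 / p.2.1) (z, r, θ) :=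
        ContDiffAt.div (by fun_prop) (by fun_prop) hr0
      exact h1.neg.prodMk (contDiffAt_const.mul (h2.sub h3))
    obtain ⟨K, t, ht, hK⟩ := h.exists_lipschitzOnWith
    exact ⟨K, t, mem_nhdsWithin_of_mem_nhds ht, hK⟩

namespace CapillaryAt

variable {m : ℕ} {r θ : ℝ → ℝ} {z : ℝ}

lemma hasDerivAt_prodMk (h : CapillaryAt m r θ z) :
    HasDerivAt (fun w => (r w, θ w)) (capillaryField m (z, r z, θ z)) z :=
  h.deriv_r.prodMk h.deriv_theta

lemma hasDerivAt_tan (h : CapillaryAt m r θ z) :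
    HasDerivAt (fun w => Real.tan (θ w))
      (m * (1 + Real.tan (θ z) ^ 2) * (z * (Real.cos (θ z))⁻¹ - (r z)⁻¹)) z := by
  have hc := h.cos_pos
  have hr := h.r_pos
  refine ((Real.hasDerivAt_tan hc.ne').comp z h.deriv_theta).congr_deriv ?_
  rw [Real.tan_eq_sin_div_cos, div_pow, Real.sin_sq]
  field_simp
  ring

end CapillaryAt

lemma exists_box {m : ℕ} {r θ : ℝ → ℝ} {a b : ℝ} (hab : a ≤ b)
    (h : ∀ z ∈ Icc a b, CapillaryAt m r θ z) :
    ∃ ρ R Θ : ℝ, 0 < ρ ∧ Θ < Real.pi / 2 ∧ ∀ z ∈ Icc a b, r z ∈ Icc ρ R ∧ θ z ∈ Icc (-Θ) Θ := by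
  have hr : ContinuousOn r (Icc a b) := fun z hz =>
    (h z hz).deriv_r.continuousAt.continuousWithinAt
  have hθ : ContinuousOn (fun z => |θ z|) (Icc a b) := fun z hz =>
    (h z hz).deriv_theta.continuousAt.continuousWithinAt.abs
  have hne : (Icc a b).Nonempty := ⟨a, left_mem_Icc.2 hab⟩
  obtain ⟨z₁, hz₁, h₁⟩ := isCompact_Icc.exists_isMinOn hne hr
  obtain ⟨z₂, hz₂, h₂⟩ := isCompact_Icc.exists_isMaxOn hne hr
  obtain ⟨z₃, hz₃, h₃⟩ := isCompact_Icc.exists_isMaxOn hne hθ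
  refine ⟨r z₁, r z₂, |θ z₃|, (h z₁ hz₁).r_pos, abs_lt.2 (h z₃ hz₃).theta_mem, fun z hz => ?_⟩
  exact ⟨⟨h₁ hz, h₂ hz⟩, abs_le.1 (h₃ hz)⟩

lemma eqOn_of_eq_right {m : ℕ} {r₁ θ₁ r₂ θ₂ : ℝ → ℝ} {a b : ℝ} (hab : a ≤ b)
    (h₁ : ∀ z ∈ Icc a b, CapillaryAt m r₁ θ₁ z) (h₂ : ∀ z ∈ Icc a b, CapillaryAt m r₂ θ₂ z)
    (hr : r₁ b = r₂ b) (hθ : θ₁ b = θ₂ b) :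
    r₁ a = r₂ a ∧ θ₁ a = θ₂ a := by
  obtain ⟨ρ₁, R₁, Θ₁, hρ₁, hΘ₁, hb₁⟩ := exists_box hab h₁
  obtain ⟨ρ₂, R₂, Θ₂, hρ₂, hΘ₂, hb₂⟩ := exists_box hab h₂
  obtain ⟨K, hK⟩ := exists_lipschitzOnWith_capillaryField m a b (R := max R₁ R₂)
    (lt_min hρ₁ hρ₂) (max_lt hΘ₁ hΘ₂)
  have hmem₁ : ∀ z ∈ Icc a b, (r₁ z, θ₁ z) ∈ Icc (min ρ₁ ρ₂) (max R₁ R₂) ×ˢ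
      Icc (-(max Θ₁ Θ₂)) (max Θ₁ Θ₂) := fun z hz =>
    ⟨⟨(min_le_left _ _).trans (hb₁ z hz).1.1, (hb₁ z hz).1.2.trans (le_max_left _ _)⟩,
      ⟨(neg_le_neg (le_max_left _ _)).trans (hb₁ z hz).2.1,
        (hb₁ z hz).2.2.trans (le_max_left _ _)⟩⟩
  have hmem₂ : ∀ z ∈ Icc a b, (r₂ z, θ₂ z) ∈ Icc (min ρ₁ ρ₂) (max R₁ R₂) ×ˢ
      Icc (-(max Θ₁ Θ₂)) (max Θ₁ Θ₂) := fun z hz =>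
    ⟨⟨(min_le_right _ _).trans (hb₂ z hz).1.1, (hb₂ z hz).1.2.trans (le_max_right _ _)⟩,
      ⟨(neg_le_neg (le_max_right _ _)).trans (hb₂ z hz).2.1,
        (hb₂ z hz).2.2.trans (le_max_right _ _)⟩⟩
  have key := ODE_solution_unique_of_mem_Icc_left (a := a) (b := b) (K := K)
    (v := fun z x => capillaryField m (z, x))
    (s := fun _ => Icc (min ρ₁ ρ₂) (max R₁ R₂) ×ˢ Icc (-(max Θ₁ Θ₂)) (max Θ₁ Θ₂))
    (f := fun z => (r₁ z, θ₁ z)) (g := fun z => (r₂ z, θ₂ z))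
    (fun z hz x hx y hy => by
      have hz' := Ioc_subset_Icc_self hz
      have := hK (x := (z, x)) ⟨hz', hx⟩ (y := (z, y)) ⟨hz', hy⟩
      simpa [Prod.edist_eq] using this)
    (fun z hz => (h₁ z hz).hasDerivAt_prodMk.continuousAt.continuousWithinAt)
    (fun z hz => (h₁ z (Ioc_subset_Icc_self hz)).hasDerivAt_prodMk.hasDerivWithinAt)
    (fun z hz => hmem₁ z (Ioc_subset_Icc_self hz))
    (fun z hz => (h₂ z hz).hasDerivAt_prodMk.continuousAt.continuousWithinAt)
    (fun z hz => (h₂ z (Ioc_subset_Icc_self hz)).hasDerivAt_prodMk.hasDerivWithinAt)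
    (fun z hz => hmem₂ z (Ioc_subset_Icc_self hz))
    (by simp [hr, hθ]) (left_mem_Icc.2 hab)
  simpa using key

/-! ### Uniqueness of the global solution -/

section uniqueness

variable {m : ℕ} {r₁ θ₁ r₂ θ₂ : ℝ → ℝ}

/-- A squared distance between two solutions which does not decrease as soon as both `r₁` and `r₂`
are decreasing. -/
noncomputable def solutionDistSq (m : ℕ) (r₁ θ₁ r₂ θ₂ : ℝ → ℝ) (z : ℝ) : ℝ :=
  m * ((1 + Real.tan (θ₂ z) ^ 2) / (r₁ z * r₂ z) * (r₁ z - r₂ z) ^ 2)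
    + (Real.tan (θ₁ z) - Real.tan (θ₂ z)) ^ 2

/-- The derivative of `solutionDistSq`, in terms of `tᵢ = tan θᵢ` and `wᵢ = 1 / cos θᵢ`. -/
noncomputable def solutionDistSqDeriv (m : ℕ) (z r₁ t₁ w₁ r₂ t₂ w₂ : ℝ) : ℝ :=
  m * (((1 + t₂ ^ 2) * t₁ / r₁ + t₂ * (1 + t₂ ^ 2) * (2 * m * (z * w₂ - r₂⁻¹) + r₂⁻¹))
      / (r₁ * r₂) * (r₁ - r₂) ^ 2)
    + 2 * m * ((t₁ - t₂) * (z * (w₁ ^ 3 - w₂ ^ 3) - (t₁ ^ 2 - t₂ ^ 2) * r₁⁻¹))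

lemma one_add_tan_sq_eq {x : ℝ} (h : Real.cos x ≠ 0) :
    1 + Real.tan x ^ 2 = (Real.cos x)⁻¹ ^ 2 := by
  rw [Real.tan_eq_sin_div_cos, div_pow, Real.sin_sq]
  field_simp
  ring

/-- The weight `(1 + t₂ ^ 2) / (r₁ * r₂)` is chosen so that the mixed terms in `(r₁ - r₂) * (t₁ -
t₂)` cancel. -/
lemma hasDerivAt_solutionDistSq {z : ℝ} (h₁ : CapillaryAt m r₁ θ₁ z)
    (h₂ : CapillaryAt m r₂ θ₂ z) :
    HasDerivAt (solutionDistSq m r₁ θ₁ r₂ θ₂)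
      (solutionDistSqDeriv m z (r₁ z) (Real.tan (θ₁ z)) (Real.cos (θ₁ z))⁻¹
        (r₂ z) (Real.tan (θ₂ z)) (Real.cos (θ₂ z))⁻¹) z := by
  have hr₁ := h₁.r_pos
  have hr₂ := h₂.r_pos
  have w₁ := one_add_tan_sq_eq h₁.cos_pos.ne'
  have w₂ := one_add_tan_sq_eq h₂.cos_pos.ne'
  have d₁ := h₁.hasDerivAt_tan
  have d₂ := h₂.hasDerivAt_tan
  have key := (((((d₂.fun_pow 2).const_add 1).fun_div (h₁.deriv_r.fun_mul h₂.deriv_r)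
    (by positivity)).fun_mul ((h₁.deriv_r.fun_sub h₂.deriv_r).fun_pow 2)).const_mul (m : ℝ)).fun_add
    ((d₁.fun_sub d₂).fun_pow 2)
  refine key.congr_deriv ?_
  unfold solutionDistSqDeriv
  have e₁ : (Real.cos (θ₁ z))⁻¹ ^ 3
    = (1 + Real.tan (θ₁ z) ^ 2) * (Real.cos (θ₁ z))⁻¹ := by rw [w₁]; ring
  have e₂ : (Real.cos (θ₂ z))⁻¹ ^ 3
    = (1 + Real.tan (θ₂ z) ^ 2) * (Real.cos (θ₂ z))⁻¹ := by rw [w₂]; ring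
  rw [e₁, e₂]
  generalize (Real.cos (θ₁ z))⁻¹ = v₁
  generalize (Real.cos (θ₂ z))⁻¹ = v₂
  rcases eq_or_ne (m : ℝ) 0 with h0 | h0
  · simp [h0]
  field_simp
  norm_num
  ring

lemma solutionDistSqDeriv_nonneg {z r₁ t₁ w₁ r₂ t₂ w₂ : ℝ} (hz : 0 < z) (hr₁ : 0 < r₁)
    (hr₂ : 0 < r₂) (ht₁ : 0 ≤ t₁) (ht₂ : 0 ≤ t₂) (hw₁ : 1 ≤ w₁) (hw₂ : 1 ≤ w₂)
    (e₁ : 1 + t₁ ^ 2 = w₁ ^ 2) (e₂ : 1 + t₂ ^ 2 = w₂ ^ 2) (h₁ : 2 ≤ 3 * (z * r₁))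
    (h₂ : 0 ≤ 2 * m * (z * r₂ - 1) + 1) : 0 ≤ solutionDistSqDeriv m z r₁ t₁ w₁ r₂ t₂ w₂ := by
  unfold solutionDistSqDeriv
  have a₂ : 0 ≤ 2 * m * (z * w₂ - r₂⁻¹) + r₂⁻¹ := by
    have : 2 * m * (z * w₂ - r₂⁻¹) + r₂⁻¹ = 2 * m * (z * (w₂ - 1))
        + (2 * m * (z * r₂ - 1) + 1) / r₂ := by
      field_simp; ring
    rw [this]
    have : 0 ≤ w₂ - 1 := by linarith
    positivity
  have a₁ : r₁⁻¹ ≤ 3 / 2 * z := by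
    rw [inv_le_iff_one_le_mul₀ hr₁]
    linarith
  have b : 0 ≤ (t₁ - t₂) * (z * (w₁ ^ 3 - w₂ ^ 3) - (t₁ ^ 2 - t₂ ^ 2) * r₁⁻¹) := by
    -- Since `w₁ ^ 2 - w₂ ^ 2 = t₁ ^ 2 - t₂ ^ 2`, the factor `k` converts differences of `w` into
    -- differences of `t`, and `(t₁ - t₂) ^ 2 * k` comes out of the whole expression.
    set k := (t₁ + t₂) / (w₁ + w₂) with hk
    have hk0 : 0 ≤ k := by positivity
    have hw : w₁ - w₂ = (t₁ - t₂) * k := by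
      rw [hk]
      field_simp
      linarith
    have e : (t₁ - t₂) * (z * (w₁ ^ 3 - w₂ ^ 3) - (t₁ ^ 2 - t₂ ^ 2) * r₁⁻¹)
        = (t₁ - t₂) ^ 2 * k * (z * (w₁ ^ 2 + w₁ * w₂ + w₂ ^ 2) - (w₁ + w₂) * r₁⁻¹) := by
      have e3 : w₁ ^ 3 - w₂ ^ 3 = (t₁ - t₂) * k * (w₁ ^ 2 + w₁ * w₂ + w₂ ^ 2) := by
        rw [← hw]; ring
      have e4 : t₁ ^ 2 - t₂ ^ 2 = (t₁ - t₂) * k * (w₁ + w₂) := by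
        rw [← hw]; linarith
      rw [e3, e4]; ring
    rw [e]
    have h3 : (w₁ + w₂) * r₁⁻¹ ≤ (w₁ + w₂) * (3 / 2 * z) := by gcongr
    have h4 : 3 / 2 * (w₁ + w₂) ≤ w₁ ^ 2 + w₁ * w₂ + w₂ ^ 2 := by nlinarith
    have h5 : z * (3 / 2 * (w₁ + w₂)) ≤ z * (w₁ ^ 2 + w₁ * w₂ + w₂ ^ 2) := by gcongr
    have h6 : 0 ≤ z * (w₁ ^ 2 + w₁ * w₂ + w₂ ^ 2) - (w₁ + w₂) * r₁⁻¹ := by linarith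
    positivity
  positivity

lemma eventually_eq_of_global (hm : 1 ≤ m) (h₁ : ∀ z, 0 < z → CapillaryAt m r₁ θ₁ z)
    (h₂ : ∀ z, 0 < z → CapillaryAt m r₂ θ₂ z) :
    ∀ᶠ z in atTop, r₁ z = r₂ z ∧ θ₁ z = θ₂ z := by
  have u₁ := tendsto_mul_of_global hm h₁
  have u₂ := tendsto_mul_of_global hm h₂
  have T : ∀ {θ : ℝ → ℝ}, Tendsto θ atTop (𝓝 0) →
      Tendsto (fun z => Real.tan (θ z)) atTop (𝓝 0) := by
    intro θ hθ
    have h : ContinuousAt Real.tan 0 := Real.continuousAt_tan.2 (by simp)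
    have h' := h.tendsto
    rw [Real.tan_zero] at h'
    exact h'.comp hθ
  have t₁ := T (tendsto_theta_of_global hm h₁)
  have t₂ := T (tendsto_theta_of_global hm h₂)
  have s₁ := eventually_sin_pos hm h₁
  have s₂ := eventually_sin_pos hm h₂
  have hlim : Tendsto (solutionDistSq m r₁ θ₁ r₂ θ₂) atTop (𝓝 0) := by
    -- The first term is homogeneous of degree `0` in `(r₁, r₂)`, so each `rᵢ` may be replaced by `z
    -- * rᵢ`, which tends to `1`.
    have : Tendsto (fun z => m * ((1 + Real.tan (θ₂ z) ^ 2) / ((z * r₁ z) * (z * r₂ z))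
        * (z * r₁ z - z * r₂ z) ^ 2) + (Real.tan (θ₁ z) - Real.tan (θ₂ z)) ^ 2) atTop
        (𝓝 ((m : ℝ) * ((1 + 0 ^ 2) / (1 * 1) * (1 - 1) ^ 2) + (0 - 0) ^ 2)) :=
      (((((t₂.pow 2).const_add 1).div (u₁.mul u₂) (by norm_num)).mul
        ((u₁.sub u₂).pow 2)).const_mul (m : ℝ)).add ((t₁.sub t₂).pow 2)
    have h0 : ((m : ℝ) * ((1 + 0 ^ 2) / (1 * 1) * (1 - 1) ^ 2) + (0 - 0) ^ 2 : ℝ) = 0 := by norm_num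
    rw [h0] at this
    refine this.congr' ?_
    filter_upwards [eventually_gt_atTop 0] with z hz
    have := (h₁ z hz).r_pos
    have := (h₂ z hz).r_pos
    unfold solutionDistSq
    field_simp
  have hQ : ∀ᶠ z in atTop, solutionDistSq m r₁ θ₁ r₂ θ₂ z ≤ 0 := by
    refine eventually_nonpos_of_deriv_nonneg (f' := fun z =>
      solutionDistSqDeriv m z (r₁ z) (Real.tan (θ₁ z)) (Real.cos (θ₁ z))⁻¹
        (r₂ z) (Real.tan (θ₂ z)) (Real.cos (θ₂ z))⁻¹) ?_ ?_ hlim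
    · filter_upwards [eventually_gt_atTop 0] with z hz
      exact hasDerivAt_solutionDistSq (h₁ z hz) (h₂ z hz)
    · have c₁ : ∀ᶠ z in atTop, 2 / 3 < z * r₁ z := u₁.eventually_const_lt (by norm_num)
      have c₂ : ∀ᶠ z in atTop, 0 < 2 * (m : ℝ) * (z * r₂ z - 1) + 1 := by
        have : Tendsto (fun z => 2 * (m : ℝ) * (z * r₂ z - 1) + 1) atTop
          (𝓝 (2 * m * (1 - 1) + 1)) := ((u₂.sub_const 1).const_mul (2 * (m : ℝ))).add_const 1
        exact this.eventually_const_lt (by norm_num)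
      filter_upwards [eventually_gt_atTop 0, s₁, s₂, c₁, c₂] with z hz hs₁ hs₂ hc₁ hc₂
      have p₁ := (h₁ z hz).cos_pos
      have p₂ := (h₂ z hz).cos_pos
      refine solutionDistSqDeriv_nonneg hz (h₁ z hz).r_pos (h₂ z hz).r_pos ?_ ?_
        ((one_le_inv₀ p₁).2 (Real.cos_le_one _)) ((one_le_inv₀ p₂).2 (Real.cos_le_one _))
        (one_add_tan_sq_eq p₁.ne') (one_add_tan_sq_eq p₂.ne') (by linarith) hc₂.le
      · rw [Real.tan_eq_sin_div_cos]; positivity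
      · rw [Real.tan_eq_sin_div_cos]; positivity
  filter_upwards [hQ, eventually_gt_atTop 0] with z hz hz0
  have q₁ := (h₁ z hz0).r_pos
  have q₂ := (h₂ z hz0).r_pos
  have hm0 : (0 : ℝ) < m := by exact_mod_cast hm
  unfold solutionDistSq at hz
  have a : 0 ≤ m * ((1 + Real.tan (θ₂ z) ^ 2) / (r₁ z * r₂ z) * (r₁ z - r₂ z) ^ 2) := by
    positivity
  have b := sq_nonneg (Real.tan (θ₁ z) - Real.tan (θ₂ z))
  constructor
  · have h0 : m * ((1 + Real.tan (θ₂ z) ^ 2) / (r₁ z * r₂ z) * (r₁ z - r₂ z) ^ 2) = 0 := by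
      linarith
    have hpos : 0 < (1 + Real.tan (θ₂ z) ^ 2) / (r₁ z * r₂ z) := by positivity
    have := (mul_eq_zero.1 ((mul_eq_zero.1 h0).resolve_left hm0.ne')).resolve_left hpos.ne'
    exact sub_eq_zero.1 (pow_eq_zero_iff two_ne_zero |>.1 this)
  · have h0 : (Real.tan (θ₁ z) - Real.tan (θ₂ z)) ^ 2 = 0 := by linarith
    exact Real.injOn_tan (h₁ z hz0).theta_mem (h₂ z hz0).theta_mem
      (sub_eq_zero.1 (pow_eq_zero_iff two_ne_zero |>.1 h0))

lemma eq_of_global (hm : 1 ≤ m) (h₁ : ∀ z, 0 < z → CapillaryAt m r₁ θ₁ z)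
    (h₂ : ∀ z, 0 < z → CapillaryAt m r₂ θ₂ z) {z : ℝ} (hz : 0 < z) :
    r₁ z = r₂ z ∧ θ₁ z = θ₂ z := by
  obtain ⟨b, ⟨hr, hθ⟩, hzb⟩ :=
    ((eventually_eq_of_global hm h₁ h₂).and (eventually_ge_atTop z)).exists
  exact eqOn_of_eq_right hzb (fun w hw => h₁ w (hz.trans_le hw.1))
    (fun w hw => h₂ w (hz.trans_le hw.1)) hr hθ

end uniqueness

/-! ### Existence on compact intervals by solving towards zero -/

/-- The estimates `b ≤ r`, `z * r ≤ 2` and `z * r ≤ 2 * cos θ` place the solution strictly inside a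
slightly larger box. This strictness is what closes the continuation argument. -/
lemma mem_box_of_le_hamiltonian {m : ℕ} (hm : 1 ≤ m) {r θ : ℝ → ℝ} {a b z : ℝ} (ha : 0 < a)
    (hb : 0 < b) (hb1 : b ≤ 1) (hz : a ≤ z) (h : CapillaryAt m r θ z)
    (hH : b ≤ hamiltonian m r θ z) :
    (r z, θ z) ∈ Ioo (b / 2) (3 / a) ×ˢ
      Ioo (-Real.arccos (a * b / 4)) (Real.arccos (a * b / 4)) := by
  have hr := h.r_pos
  have hz0 := h.z_pos
  have h1 := le_of_le_hamiltonian hm hz0 hr hb1 hH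
  have h2 := mul_le_two_of_hamiltonian_nonneg hm hz0 hr (hb.le.trans hH)
  have h3 := mul_le_two_mul_cos_of_hamiltonian_nonneg hm hz0 hr (hb.le.trans hH)
  have h4 : a * b ≤ z * r z := by gcongr
  have h5 : a * b / 4 < Real.cos (θ z) := by
    have : 0 < a * b := by positivity
    linarith
  obtain ⟨t1, t2⟩ := h.theta_mem
  have h6 : |θ z| < Real.arccos (a * b / 4) := by
    rw [← Real.arccos_cos (abs_nonneg (θ z)) (by rw [abs_le]; constructor <;> linarith [Real.pi_pos]),
      Real.cos_abs]
    exact Real.arccos_lt_arccos (by linarith [mul_pos ha hb]) h5 (Real.cos_le_one _)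
  refine ⟨⟨by simp only; linarith, ?_⟩, abs_lt.1 h6⟩
  simp only
  rw [lt_div_iff₀ ha]
  have : a * r z ≤ z * r z := by gcongr
  linarith

/-- The rectangle in the `(r, θ)`-plane containing the solutions whose Hamiltonian is at least `b`,
at heights at least `a`. -/
noncomputable def solutionBox (a b : ℝ) : Set (ℝ × ℝ) :=
  Icc (b / 2) (3 / a) ×ˢ Icc (-Real.arccos (a * b / 4)) (Real.arccos (a * b / 4))

/-- Projecting the state onto the box makes the field bounded and Lipschitz for all states, so a
solution exists on the whole interval. Inside the box it solves the original system. -/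
lemma exists_clamped_solution (m : ℕ) {z₀ z₁ N ρ R Θ : ℝ} (hN : N ∈ Icc z₀ z₁) (hρ : 0 < ρ)
    (hρR : ρ ≤ R) (hΘ0 : -Θ ≤ Θ) (hΘ : Θ < Real.pi / 2) (x₀ : ℝ × ℝ) :
    ∃ x : ℝ → ℝ × ℝ, x N = x₀ ∧ ∀ z ∈ Ioo z₀ z₁, HasDerivAt x
      (capillaryField m (z, (projIcc ρ R hρR (x z).1 : ℝ), (projIcc (-Θ) Θ hΘ0 (x z).2 : ℝ))) z := by
  obtain ⟨K, hK⟩ := exists_lipschitzOnWith_capillaryField m z₀ z₁ (R := R) hρ hΘ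
  have hcomp : IsCompact (Icc z₀ z₁ ×ˢ (Icc ρ R ×ˢ Icc (-Θ) Θ)) :=
    isCompact_Icc.prod (isCompact_Icc.prod isCompact_Icc)
  obtain ⟨L, hL⟩ := hcomp.exists_bound_of_continuousOn hK.continuousOn
  set f : ℝ → ℝ × ℝ → ℝ × ℝ := fun z x =>
    capillaryField m (z, (projIcc ρ R hρR x.1 : ℝ), (projIcc (-Θ) Θ hΘ0 x.2 : ℝ)) with hf
  have hmem : ∀ z ∈ Icc z₀ z₁, ∀ x : ℝ × ℝ,
      (z, (projIcc ρ R hρR x.1 : ℝ), (projIcc (-Θ) Θ hΘ0 x.2 : ℝ)) ∈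
        Icc z₀ z₁ ×ˢ (Icc ρ R ×ˢ Icc (-Θ) Θ) := fun z hz x =>
    ⟨hz, (projIcc ρ R hρR x.1).2, (projIcc (-Θ) Θ hΘ0 x.2).2⟩
  have hM : 0 ≤ max (z₁ - N) (N - z₀) := le_max_of_le_left (by linarith [hN.2])
  have hPL : IsPicardLindelof f (⟨N, hN⟩ : Icc z₀ z₁) x₀
      (L.toNNReal * (max (z₁ - N) (N - z₀)).toNNReal) 0 L.toNNReal K := by
    refine ⟨?_, ?_, ?_, ?_⟩
    · intro z hz x _ y _
      refine (hK (hmem z hz x) (hmem z hz y)).trans ?_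
      gcongr
      rw [Prod.edist_eq, Prod.edist_eq, Prod.edist_eq]
      have e1 := LipschitzWith.projIcc hρR x.1 y.1
      have e2 := LipschitzWith.projIcc hΘ0 x.2 y.2
      simp only [ENNReal.coe_one, one_mul] at e1 e2
      simp only [edist_self]
      exact max_le zero_le (max_le_max e1 e2)
    · intro x _
      exact hK.continuousOn.comp (by fun_prop) fun z hz => hmem z hz x
    · intro z hz x _
      exact (hL _ (hmem z hz x)).trans (Real.le_coe_toNNReal L)
    · rw [NNReal.coe_mul, NNReal.coe_zero, sub_zero, Real.coe_toNNReal _ hM]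
  obtain ⟨x, hx0, hx⟩ := hPL.exists_eq_forall_mem_Icc_hasDerivWithinAt₀
  refine ⟨x, hx0, fun z hz => ?_⟩
  exact (hx z (Ioo_subset_Icc_self hz)).hasDerivAt (Icc_mem_nhds hz.1 hz.2)

lemma exists_solution_left {m : ℕ} (hm : 1 ≤ m) {δ N : ℝ} (hδ : 0 < δ) (hδN : δ ≤ N)
    (hN : 1 ≤ N) :
    ∃ r θ : ℝ → ℝ, r N = 1 / N ∧ θ N = 0 ∧
      ∀ z ∈ Icc δ N, CapillaryAt m r θ z ∧ 0 ≤ hamiltonian m r θ z := by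
  have hN0 : 0 < N := by linarith
  -- The Hamiltonian of the data `(1 / N, 0)` at height `N`; it can only be larger to the left.
  set b : ℝ := (1 / N) ^ m / (m + 1) with hb
  have hb0 : 0 < b := by positivity
  have hpow : (1 / N) ^ m ≤ 1 := pow_le_one₀ (by positivity) (by rw [div_le_one hN0]; exact hN)
  have hb1 : b ≤ 1 := by
    rw [hb, div_le_one (by positivity)]
    linarith [(Nat.cast_nonneg m : (0 : ℝ) ≤ m)]
  have hbN : b ≤ 1 / N := by
    have h1 : (1 / N) ^ m ≤ 1 / N :=
      pow_le_of_le_one (by positivity) (by rw [div_le_one hN0]; exact hN) (by omega)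
    have h2 : b ≤ (1 / N) ^ m := div_le_self (by positivity)
      (by linarith [(Nat.cast_nonneg m : (0 : ℝ) ≤ m)])
    exact h2.trans h1
  have hNδ : 1 / N ≤ 1 / δ := one_div_le_one_div_of_le hδ hδN
  have h3δ : 1 / δ < 3 / δ := by gcongr; norm_num
  set Θ := Real.arccos (δ * b / 4) with hΘdef
  have hΘ : Θ < Real.pi / 2 := Real.arccos_lt_pi_div_two.2 (by positivity)
  have hδb : δ * b ≤ 1 := by
    calc δ * b ≤ δ * (1 / δ) := by gcongr; exact hbN.trans hNδ
      _ = 1 := by field_simp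
  have hΘ0 : 0 < Θ := Real.arccos_pos.2 (by linarith)
  have hρR : b / 2 ≤ 3 / δ := by linarith
  obtain ⟨x, hxN, hx⟩ := exists_clamped_solution m (z₀ := δ / 2) (z₁ := N + 1) (N := N)
    ⟨by linarith, by linarith⟩ (half_pos hb0) hρR (by linarith : -Θ ≤ Θ) hΘ (1 / N, 0)
  have hsub : Icc δ N ⊆ Ioo (δ / 2) (N + 1) := fun z hz =>
    ⟨by linarith [hz.1], by linarith [hz.2]⟩
  set r : ℝ → ℝ := fun z => (x z).1 with hr
  set θ : ℝ → ℝ := fun z => (x z).2 with hθ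
  have hcap : ∀ z ∈ Icc δ N, x z ∈ solutionBox δ b → CapillaryAt m r θ z := by
    intro z hz hbox
    have hd := hx z (hsub hz)
    rw [projIcc_of_mem hρR hbox.1, projIcc_of_mem _ hbox.2] at hd
    refine ⟨hδ.trans_le hz.1, (half_pos hb0).trans_le hbox.1.1, ?_, hd.fst, hd.snd⟩
    exact ⟨by linarith [hbox.2.1], by linarith [hbox.2.2]⟩
  have hcont : ContinuousOn x (Icc δ N) := fun z hz =>
    (hx z (hsub hz)).continuousAt.continuousWithinAt
  have hHN : hamiltonian m r θ N = b := by
    have e1 : r N = 1 / N := by simp [hr, hxN]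
    have e2 : θ N = 0 := by simp [hθ, hxN]
    unfold hamiltonian
    rw [e1, e2, hb, Real.cos_zero, pow_succ]
    field_simp
    ring
  have hle : ∀ z ∈ Icc δ N, (∀ w ∈ Icc z N, x w ∈ solutionBox δ b) →
      b ≤ hamiltonian m r θ z := by
    intro z hz hw
    rw [← hHN]
    exact antitoneOn_hamiltonian hm (convex_Icc z N)
      (fun w hw' => hcap w ⟨hz.1.trans hw'.1, hw'.2⟩ (hw w hw'))
      (left_mem_Icc.2 hz.2) (right_mem_Icc.2 hz.2) hz.2
  have hNO : x N ∈ Ioo (b / 2) (3 / δ) ×ˢ Ioo (-Θ) Θ := by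
    rw [hxN]
    exact ⟨⟨by simp only; linarith, by simp only; linarith⟩,
      ⟨by simp only; linarith, by simp only; linarith⟩⟩
  have hgood : ∀ z ∈ Icc δ N, x z ∈ Ioo (b / 2) (3 / δ) ×ˢ Ioo (-Θ) Θ := by
    by_contra! hbad
    -- At the largest height `y` where the open box is missed, the closed box still contains the
    -- solution on `[y, N]`. There the clamping is inactive and `b ≤ H`, which puts `y` back in the
    -- open box.
    set S := Icc δ N ∩ x ⁻¹' (Ioo (b / 2) (3 / δ) ×ˢ Ioo (-Θ) Θ)ᶜ with hS
    have hSne : S.Nonempty := by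
      obtain ⟨z, hz, hz'⟩ := hbad
      exact ⟨z, hz, hz'⟩
    have hScl : IsClosed S := hcont.preimage_isClosed_of_isClosed isClosed_Icc
      (isOpen_Ioo.prod isOpen_Ioo).isClosed_compl
    have hSbdd : BddAbove S := ⟨N, fun z hz => hz.1.2⟩
    obtain ⟨hy1, hy2⟩ := hScl.csSup_mem hSne hSbdd
    set y := sSup S with hy
    have hyN : y < N := by
      refine lt_of_le_of_ne hy1.2 fun h => hy2 ?_
      rw [h]; exact hNO
    have hC : IsClosed (Icc δ N ∩ x ⁻¹' solutionBox δ b) :=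
      hcont.preimage_isClosed_of_isClosed isClosed_Icc (isClosed_Icc.prod isClosed_Icc)
    have hIoc : Ioc y N ⊆ Icc δ N ∩ x ⁻¹' solutionBox δ b := by
      intro w hw
      have hwI : w ∈ Icc δ N := ⟨hy1.1.trans hw.1.le, hw.2⟩
      refine ⟨hwI, ?_⟩
      by_contra hnot
      have : w ∈ S := ⟨hwI, fun hO => hnot
        ⟨Ioo_subset_Icc_self hO.1, Ioo_subset_Icc_self hO.2⟩⟩
      exact absurd (le_csSup hSbdd this) (not_le.2 hw.1)
    have hIcc : Icc y N ⊆ Icc δ N ∩ x ⁻¹' solutionBox δ b := by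
      rw [← closure_Ioc hyN.ne]
      exact closure_minimal hIoc hC
    exact hy2 (mem_box_of_le_hamiltonian hm hδ hb0 hb1 hy1.1
      (hcap y hy1 (hIcc (left_mem_Icc.2 hyN.le)).2) (hle y hy1 fun w hw => (hIcc hw).2))
  have hbox : ∀ z ∈ Icc δ N, x z ∈ solutionBox δ b := fun z hz =>
    ⟨Ioo_subset_Icc_self (hgood z hz).1, Ioo_subset_Icc_self (hgood z hz).2⟩
  refine ⟨r, θ, by simp [hr, hxN], by simp [hθ, hxN], fun z hz => ⟨hcap z hz (hbox z hz), ?_⟩⟩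
  exact hb0.le.trans (hle z hz fun w hw => hbox w ⟨hz.1.trans hw.1, hw.2⟩)

/-- The gap estimate at `B` bounds the Hamiltonian there from below by a constant independent of the
starting height `N`, and monotonicity extends the bound to the left. -/
lemma exists_uniform_box {m : ℕ} (hm : 1 ≤ m) :
    ∃ Z : ℝ, ∀ B, Z ≤ B → ∀ a, 0 < a → ∃ b, 0 < b ∧ ∀ (r θ : ℝ → ℝ) (N : ℝ), B ≤ N →
      (∀ z ∈ Icc a N, CapillaryAt m r θ z ∧ 0 ≤ hamiltonian m r θ z) →
      r N = 1 / N → θ N = 0 → ∀ z ∈ Icc a B, (r z, θ z) ∈ solutionBox a b := by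
  obtain ⟨C, hC, -, hgap⟩ := exists_energy_gap_bound m hm
  -- For such `B` the gap at `B` is at most half of the maximal energy.
  refine ⟨max 1 (2 * (m + 1) * C), fun B hB a ha => ?_⟩
  have hB1 : 1 ≤ B := (le_max_left _ _).trans hB
  have hB2 : 2 * (m + 1) * C ≤ B := (le_max_right _ _).trans hB
  have hB0 : 0 < B := by linarith
  have hBm : 1 ≤ B ^ m := one_le_pow₀ hB1
  set b : ℝ := 1 / (2 * (m + 1)) / B ^ m with hb
  have hb0 : 0 < b := by positivity
  have hb1 : b ≤ 1 := by
    rw [hb, div_div, div_le_one (by positivity)]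
    have := (Nat.cast_nonneg m : (0 : ℝ) ≤ m)
    nlinarith
  refine ⟨b, hb0, fun r θ N hBN hsol hrN hθN z hz => ?_⟩
  have haB : a ≤ B := hz.1.trans hz.2
  have hg := hgap r θ B N hBN (fun w hw => hsol w ⟨haB.trans hw.1, hw.2⟩) hrN hθN
  have hCB : C / B ^ 2 ≤ 1 / (2 * (m + 1)) := by
    rw [div_le_div_iff₀ (by positivity) (by positivity)]
    nlinarith
  have hEB : 1 / (2 * ((m : ℝ) + 1)) ≤ energy m (B * r B) (Real.cos (θ B)) := by
    have : 1 / ((m : ℝ) + 1) = 1 / (2 * (m + 1)) + 1 / (2 * (m + 1)) := by field_simp; norm_num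
    linarith
  have hHB : b ≤ hamiltonian m r θ B := by
    rw [energy_eq_hamiltonian] at hEB
    rw [hb, div_le_iff₀ (by positivity)]
    linarith
  have hHz : b ≤ hamiltonian m r θ z := by
    refine hHB.trans (antitoneOn_hamiltonian hm (convex_Icc a N) (fun w hw => (hsol w hw).1)
      ⟨hz.1, hz.2.trans hBN⟩ ⟨haB, hBN⟩ hz.2)
  have := mem_box_of_le_hamiltonian hm ha hb0 hb1 hz.1 (hsol z ⟨hz.1, hz.2.trans hBN⟩).1 hHz
  exact ⟨Ioo_subset_Icc_self this.1, Ioo_subset_Icc_self this.2⟩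

/-! ### Passage to the limit -/

section limits

variable {E : Type*} [NormedAddCommGroup E] [NormedSpace ℝ E]

open scoped NNReal in
/-- A uniform second-order Taylor estimate for the solutions of an ordinary differential equation
with Lipschitz right-hand side. -/
lemma norm_sub_sub_smul_le {f : ℝ × E → E} {x : ℝ → E} {s : Set (ℝ × E)} {K : ℝ≥0} {L a b : ℝ}
    (hK : LipschitzOnWith K f s) (hL : ∀ p ∈ s, ‖f p‖ ≤ L)
    (hx : ∀ t ∈ Icc a b, HasDerivAt x (f (t, x t)) t) (hs : ∀ t ∈ Icc a b, (t, x t) ∈ s)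
    {z w : ℝ} (hz : z ∈ Icc a b) (hw : w ∈ Icc a b) :
    ‖x w - x z - (w - z) • f (z, x z)‖ ≤ K * max 1 L * |w - z| ^ 2 := by
  have hsub : uIcc z w ⊆ Icc a b := uIcc_subset_Icc hz hw
  have h1 : ∀ t ∈ Icc a b, ‖x t - x z‖ ≤ L * ‖t - z‖ := fun t ht =>
    (convex_Icc a b).norm_image_sub_le_of_norm_hasDerivWithin_le
      (fun u hu => (hx u hu).hasDerivWithinAt) (fun u hu => hL _ (hs u hu)) hz ht
  have h2 : ∀ t ∈ uIcc z w, ‖f (t, x t) - f (z, x z)‖ ≤ K * max 1 L * |w - z| := by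
    intro t ht
    have ht' := hsub ht
    have h3 : |t - z| ≤ |w - z| := abs_sub_left_of_mem_uIcc ht
    have h4 := hK.dist_le_mul _ (hs t ht') _ (hs z hz)
    rw [dist_eq_norm] at h4
    refine h4.trans ?_
    rw [mul_assoc]
    gcongr
    rw [Prod.dist_eq]
    refine max_le ?_ ?_
    · rw [Real.dist_eq]
      calc |t - z| ≤ |w - z| := h3
        _ ≤ max 1 L * |w - z| := le_mul_of_one_le_left (abs_nonneg _) (le_max_left _ _)
    · rw [dist_eq_norm]
      refine (h1 t ht').trans ?_
      rw [Real.norm_eq_abs]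
      have : L ≤ max 1 L := le_max_right _ _
      have : 0 ≤ max 1 L := le_max_of_le_left zero_le_one
      gcongr
  have h5 := (convex_uIcc z w).norm_image_sub_le_of_norm_hasDerivWithin_le
    (f := fun t => x t - t • f (z, x z)) (f' := fun t => f (t, x t) - f (z, x z))
    (fun t ht => by
      have := (hx t (hsub ht)).fun_sub ((hasDerivAt_id t).smul_const (f (z, x z)))
      simpa using this.hasDerivWithinAt) h2 left_mem_uIcc right_mem_uIcc
  calc ‖x w - x z - (w - z) • f (z, x z)‖
      = ‖x w - w • f (z, x z) - (x z - z • f (z, x z))‖ := by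
        congr 1; rw [sub_smul]; abel
    _ ≤ K * max 1 L * |w - z| * ‖w - z‖ := h5
    _ = _ := by rw [Real.norm_eq_abs]; ring

/-- The quadratic Taylor bound involves only values of `x` and `v`, so it survives pointwise limits,
and it still yields the derivative. -/
lemma hasDerivAt_of_norm_sub_sub_smul_le {x : ℝ → E} {v : E} {z M : ℝ}
    (h : ∀ᶠ w in 𝓝 z, ‖x w - x z - (w - z) • v‖ ≤ M * |w - z| ^ 2) : HasDerivAt x v z := by
  rw [hasDerivAt_iff_isLittleO]
  have h1 : (fun w => x w - x z - (w - z) • v) =O[𝓝 z] fun w => (w - z) ^ 2 := by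
    refine IsBigO.of_bound M ?_
    filter_upwards [h] with w hw
    simpa using hw
  have h2 : (fun w : ℝ => (w - z) ^ 2) =o[𝓝 z] fun w => w - z := by
    have h3 : Tendsto (fun w : ℝ => w - z) (𝓝 z) (𝓝 0) := by
      simpa using (continuous_sub_right z).tendsto z
    exact (isLittleO_pow_id one_lt_two).comp_tendsto h3
  exact h1.trans_isLittleO h2

end limits

theorem exists_global {m : ℕ} (hm : 1 ≤ m) :
    ∃ r θ : ℝ → ℝ, ∀ z, 0 < z → CapillaryAt m r θ z := by
  have hex : ∀ k : ℕ, ∃ r θ : ℝ → ℝ, r (k + 1) = 1 / (k + 1) ∧ θ (k + 1) = 0 ∧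
      ∀ z ∈ Icc (1 / ((k : ℝ) + 1)) (k + 1), CapillaryAt m r θ z ∧ 0 ≤ hamiltonian m r θ z := by
    intro k
    have hk : (1 : ℝ) ≤ k + 1 := by linarith [(Nat.cast_nonneg k : (0 : ℝ) ≤ k)]
    refine exists_solution_left hm (by positivity) ?_ hk
    exact ((div_le_one (by positivity)).2 hk).trans hk
  choose r θ hr hθ hsol using hex
  obtain ⟨Z, hZ⟩ := exists_uniform_box hm
  -- Along a nonprincipal ultrafilter, compactness of the boxes gives pointwise limits at all
  -- heights at once, with no extraction of subsequences.
  set U : Ultrafilter ℕ := hyperfilter ℕ with hU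
  have hUle : (U : Filter ℕ) ≤ atTop := by
    rw [hU, ← Nat.cofinite_eq_atTop]
    exact hyperfilter_le_cofinite
  have hbox : ∀ z, 0 < z → ∃ b, 0 < b ∧ ∀ᶠ k in (U : Filter ℕ),
      ∀ w ∈ Icc (z / 2) (max Z (2 * z)),
        CapillaryAt m (r k) (θ k) w ∧ (r k w, θ k w) ∈ solutionBox (z / 2) b := by
    intro z hz
    obtain ⟨b, hb0, hb⟩ := hZ (max Z (2 * z)) (le_max_left _ _) (z / 2) (half_pos hz)
    refine ⟨b, hb0, ?_⟩
    have hat : Tendsto (fun k : ℕ => (k : ℝ) + 1) atTop atTop :=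
      tendsto_atTop_add_const_right _ _ tendsto_natCast_atTop_atTop
    filter_upwards [hUle (hat.eventually_ge_atTop (max Z (2 * z))),
      hUle (hat.eventually_ge_atTop (1 / (z / 2)))] with k hk1 hk2
    have hk0 : (0 : ℝ) < (k : ℝ) + 1 := by positivity
    have hlow : 1 / ((k : ℝ) + 1) ≤ z / 2 := by
      rw [div_le_iff₀ (half_pos hz)] at hk2
      rw [div_le_iff₀ hk0]
      linarith
    intro w hw
    exact ⟨(hsol k w ⟨hlow.trans hw.1, hw.2.trans hk1⟩).1,
      hb (r k) (θ k) (k + 1) hk1 (fun w hw => hsol k w ⟨hlow.trans hw.1, hw.2⟩) (hr k) (hθ k) w hw⟩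
  have hself : ∀ z : ℝ, 0 < z → Icc (z / 2) (max Z (2 * z)) ∈ 𝓝 z := fun z hz =>
    Icc_mem_nhds (by linarith) (lt_max_of_lt_right (by linarith))
  have hcompact : ∀ a b, IsCompact (solutionBox a b) := fun a b =>
    isCompact_Icc.prod isCompact_Icc
  have hlim : ∀ z, ∃ y : ℝ × ℝ, 0 < z → Tendsto (fun k => (r k z, θ k z)) U (𝓝 y) := by
    intro z
    by_cases hz : 0 < z
    · obtain ⟨b, -, hb⟩ := hbox z hz
      have : ((U.map fun k => (r k z, θ k z) : Ultrafilter (ℝ × ℝ)) : Filter (ℝ × ℝ))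
          ≤ 𝓟 (solutionBox (z / 2) b) := by
        rw [le_principal_iff]
        have : ∀ᶠ k in (U : Filter ℕ), (r k z, θ k z) ∈ solutionBox (z / 2) b :=
          hb.mono fun k hk => (hk z (mem_of_mem_nhds (hself z hz))).2
        exact this
      obtain ⟨y, -, hy⟩ := (hcompact _ _).ultrafilter_le_nhds _ this
      exact ⟨y, fun _ => hy⟩
    · exact ⟨0, fun h => absurd h hz⟩
  choose y hy using hlim
  refine ⟨fun z => (y z).1, fun z => (y z).2, fun z hz => ?_⟩
  obtain ⟨b, hb0, hb⟩ := hbox z hz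
  have hzI := mem_of_mem_nhds (hself z hz)
  have hΘ : Real.arccos (z / 2 * b / 4) < Real.pi / 2 :=
    Real.arccos_lt_pi_div_two.2 (by positivity)
  obtain ⟨K, hK⟩ := exists_lipschitzOnWith_capillaryField m (z / 2) (max Z (2 * z))
    (R := 3 / (z / 2)) (half_pos hb0) hΘ
  obtain ⟨L, hL⟩ := (isCompact_Icc.prod (hcompact (z / 2) b)).exists_bound_of_continuousOn
    hK.continuousOn
  have hyz : y z ∈ solutionBox (z / 2) b :=
    (hcompact _ _).isClosed.mem_of_tendsto (hy z hz) (hb.mono fun k hk => (hk z hzI).2)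
  have hF : Tendsto (fun k => capillaryField m (z, r k z, θ k z)) U
      (𝓝 (capillaryField m (z, y z))) := by
    have hc := hK.continuousOn (z, y z) ⟨hzI, hyz⟩
    refine hc.tendsto.comp (tendsto_nhdsWithin_iff.2 ⟨tendsto_const_nhds.prodMk_nhds (hy z hz), ?_⟩)
    filter_upwards [hb] with k hk
    exact ⟨hzI, (hk z hzI).2⟩
  -- The constant `K * max 1 L` depends only on the box around `z`, so the Taylor bound is uniform
  -- along the ultrafilter.
  have hderiv : HasDerivAt y (capillaryField m (z, y z)) z := by
    refine hasDerivAt_of_norm_sub_sub_smul_le (M := K * max 1 L) ?_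
    filter_upwards [hself z hz] with w hw
    have hw0 : 0 < w := (half_pos hz).trans_le hw.1
    have hT := (((hy w hw0).sub (hy z hz)).sub (hF.const_smul (w - z))).norm
    refine le_of_tendsto hT ?_
    filter_upwards [hb] with k hk
    exact norm_sub_sub_smul_le (x := fun t => (r k t, θ k t)) hK hL
      (fun t ht => (hk t ht).1.hasDerivAt_prodMk) (fun t ht => ⟨ht, (hk t ht).2⟩) hzI hw
  exact ⟨hz, (half_pos hb0).trans_le hyz.1.1, ⟨by linarith [hyz.2.1], by linarith [hyz.2.2]⟩,
    hderiv.fst, hderiv.snd⟩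

lemma isCapillarySolution_iff {n : ℕ} (hn : 2 ≤ n) {r θ : ℝ → ℝ} :
    IsCapillarySolution n r θ ↔ ∀ z, 0 < z → CapillaryAt (n - 1) r θ z := by
  have hcast : ((n - 1 : ℕ) : ℝ) = n - 1 := by
    rw [Nat.cast_sub (by omega), Nat.cast_one]
  constructor
  · intro h z hz
    exact ⟨hz, h.r_pos z hz, h.theta_mem z hz, h.deriv_r z hz, hcast ▸ h.deriv_theta z hz⟩
  · intro h
    exact ⟨fun z hz => (h z hz).r_pos, fun z hz => (h z hz).theta_mem,
      fun z hz => (h z hz).deriv_r, fun z hz => hcast ▸ (h z hz).deriv_theta⟩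

theorem theorem1 (n : ℕ) (hn : 2 ≤ n) :
    ∃ r θ : ℝ → ℝ,
      IsCapillarySolution n r θ ∧
      (∀ r' θ' : ℝ → ℝ, IsCapillarySolution n r' θ' →
        EqOn r' r (Ioi 0) ∧ EqOn θ' θ (Ioi 0)) ∧
      r ~[atTop] (fun z : ℝ => 1 / z) ∧
      Tendsto θ atTop (𝓝 0) := by
  have hm : 1 ≤ n - 1 := by omega
  obtain ⟨r, θ, h⟩ := exists_global hm
  refine ⟨r, θ, (isCapillarySolution_iff hn).2 h, fun r' θ' h' => ?_, ?_,
    tendsto_theta_of_global hm h⟩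
  · have h'' := (isCapillarySolution_iff hn).1 h'
    exact ⟨fun z hz => (eq_of_global hm h'' h hz).1, fun z hz => (eq_of_global hm h'' h hz).2⟩
  · refine (isEquivalent_iff_tendsto_one ?_).2 ?_
    · filter_upwards [eventually_gt_atTop 0] with z hz
      positivity
    · refine (tendsto_mul_of_global hm h).congr' ?_
      filter_upwards [eventually_gt_atTop 0] with z hz
      simp only [Pi.div_apply]
      field_simp
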